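/- Let $1<p<\infty$. A \emph{$p$-operator space} is a complex Banach space $X$ with a norm $\|\cdot\|_n$ on the $n\times n$ matrices over $X$ for each $n$ (the resulting space is $M_n(X)$; $\|\cdot\|_1$ is the norm of $X$) such that $\|u\oplus v\|_{n+m}=\max\{\|u\|_n,\|v\|_m\}$ for $u\in M_n(X)$, $v\in M_m(X)$, and $\|\alpha u\beta\|_n\le\|\alpha\|\,\|u\|_m\,\|\beta\|$ for $u\in M_m(X)$ and scalar matrices $\alpha$ ($n\times m$) and $\beta$ ($m\times n$), normed as operators $\ell_p^m\to\ell_p^n$ and $\ell_p^n\to\ell_p^m$. For example $M_n(\mathbb C)=\mathcal B(\ell_p^n)$. For a linear map $u:X\to Y$ put $\|u\|_{pcb}=\sup_n\|u_n\|$, where $u_n:M_n(X)\to M_n(Y)$ applies $u$ entrywise; $u$ is \emph{$p$-completely contractive} if $\|u\|_{pcb}\le1$. $\mathcal{CB}_p(X,Y)$ is the space of maps with $\|u\|_{pcb}<\infty$, with $M_n(\mathcal{CB}_p(X,Y))$ normed as $\mathcal{CB}_p(X,M_n(Y))$, and $X'=\mathcal{CB}_p(X,\mathbb C)$. A bilinear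 map $\psi:X\times Y\to Z$ is \emph{jointly $p$-completely contractive} if $\|[\psi(v_{ij},w_{kl})]_{(i,k),(j,l)}\|_{rs}\le\|v\|_r\|w\|_s$ for all $r,s$, $v\in M_r(X)$, $w\in M_s(Y)$. The projective tensor product $X\overset{\wedge_p}{\otimes}Y$ is the completion of the algebraic tensor product $X\otimes Y$ for the matrix norms $\|u\|_{\wedge_p}=\inf\{\|\alpha\|\|v\|\|w\|\|\beta\|: u=\alpha(v\otimes w)\beta\}$, the infimum being over all $r,s$, $v\in M_r(X)$, $w\in M_s(Y)$ and scalar matrices $\alpha,\beta$ of sizes $n\times rs$ and $rs\times n$. The injective tensor product $X\overset{\vee_p}{\otimes}Y$ is the closure of $X\otimes Y$ in $\mathcal{CB}_p(X',Y)$, where $x\otimes y$ acts as $f\mapsto f(x)y$, with the inherited matrix norms. Let $V$ and $W$ be $p$-operator spaces. Then there is a unique bilinear map $$\tilde\Psi:V'\times W'\to(V\overset{\vee_p}{\otimes}W)',\qquad (f,g)\mapsto f\otimes g,$$ with $(f\otimes g)(x\otimes y)=f(x)g(y)$ for all $f\in V'$, $g\in W'$, $x\in V$, $y\in W$, and it is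 jointly $p$-completely contractive. Hence there is a unique continuous linear map $\Psi:V'\overset{\wedge_p}{\otimes}W'\to(V\overset{\vee_p}{\otimes}W)'$ that sends the elementary tensor of $f$ and $g$ to $\tilde\Psi(f,g)$ (the canonical map), and it is $p$-completely contractive. -/

import Mathlib

open scoped TensorProduct

namespace POperator

instance factOneLeOfReal (p : ℝ) [hp : Fact (1 < p)] : Fact (1 ≤ ENNReal.ofReal p) :=
  ⟨by simpa using ENNReal.ofReal_le_ofReal hp.out.le⟩

section LpMatrix

variable (p : ℝ) [Fact (1 < p)]
variable {ι κ l ι' κ' : Type*} [Fintype ι] [Fintype κ] [Fintype l] [Fintype ι'] [Fintype κ']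

open scoped Classical in
/-- The norm of a rectangular complex matrix as an operator `ℓ_p^κ → ℓ_p^ι`. -/
noncomputable def lpOpNorm (α : Matrix ι κ ℂ) : ℝ :=
  ‖LinearMap.toContinuousLinearMap
    (Matrix.toLpLin (ENNReal.ofReal p) (ENNReal.ofReal p) α)‖

/-- The `ℓ_p` norm of a vector. -/
noncomputable def lpVec (x : ι → ℂ) : ℝ := ‖WithLp.toLp (ENNReal.ofReal p) x‖

theorem p_pos : 0 < p := lt_trans one_pos (Fact.out : 1 < p)

theorem lpVec_nonneg (x : ι → ℂ) : 0 ≤ lpVec p x := norm_nonneg _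

theorem lpVec_eq (x : ι → ℂ) : lpVec p x = (∑ i, ‖x i‖ ^ p) ^ (1 / p) := by
  have h : (ENNReal.ofReal p).toReal = p := ENNReal.toReal_ofReal (p_pos p).le
  rw [lpVec, PiLp.norm_eq_sum (by rw [h]; exact p_pos p), h]

theorem lpVec_rpow (x : ι → ℂ) : lpVec p x ^ p = ∑ i, ‖x i‖ ^ p := by
  rw [lpVec_eq, ← Real.rpow_mul (Finset.sum_nonneg fun i _ => by positivity),
    one_div_mul_cancel (p_pos p).ne', Real.rpow_one]

theorem lpOpNorm_nonneg (α : Matrix ι κ ℂ) : 0 ≤ lpOpNorm p α := by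
  classical exact norm_nonneg _

theorem lpVec_mulVec_le (α : Matrix ι κ ℂ) (x : κ → ℂ) :
    lpVec p (α.mulVec x) ≤ lpOpNorm p α * lpVec p x := by
  classical
  exact (LinearMap.toContinuousLinearMap
    (Matrix.toLpLin (ENNReal.ofReal p) (ENNReal.ofReal p) α)).le_opNorm (WithLp.toLp _ x)

theorem lpOpNorm_le (α : Matrix ι κ ℂ) {C : ℝ} (hC : 0 ≤ C)
    (h : ∀ x, lpVec p (α.mulVec x) ≤ C * lpVec p x) : lpOpNorm p α ≤ C := by
  classical
  exact ContinuousLinearMap.opNorm_le_bound _ hC fun x => h x.ofLp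

theorem lpVec_add_le (x y : ι → ℂ) : lpVec p (x + y) ≤ lpVec p x + lpVec p y :=
  norm_add_le (WithLp.toLp (ENNReal.ofReal p) x) (WithLp.toLp (ENNReal.ofReal p) y)

theorem lpVec_smul (c : ℂ) (x : ι → ℂ) : lpVec p (c • x) = ‖c‖ * lpVec p x :=
  norm_smul c (WithLp.toLp (ENNReal.ofReal p) x)

theorem lpVec_zero : lpVec p (0 : ι → ℂ) = 0 :=
  norm_zero (E := PiLp (ENNReal.ofReal p) fun _ : ι => ℂ)

theorem lpVec_comp_equiv (e : ι ≃ κ) (x : κ → ℂ) : lpVec p (x ∘ e) = lpVec p x := by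
  rw [lpVec_eq, lpVec_eq]
  congr 1
  exact Equiv.sum_comp e fun i => ‖x i‖ ^ p

theorem lpVec_sum_rpow (x : ι ⊕ κ → ℂ) :
    lpVec p x ^ p = lpVec p (x ∘ Sum.inl) ^ p + lpVec p (x ∘ Sum.inr) ^ p := by
  simp [lpVec_rpow]

theorem lpVec_mono_rpow {x : ι → ℂ} {b : ℝ} (hb : 0 ≤ b) (h : lpVec p x ^ p ≤ b ^ p) :
    lpVec p x ≤ b :=
  (Real.rpow_le_rpow_iff (lpVec_nonneg p x) hb (p_pos p)).1 h

theorem lpVec_inl_le (x : ι ⊕ κ → ℂ) : lpVec p (x ∘ Sum.inl) ≤ lpVec p x := by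
  refine lpVec_mono_rpow p (lpVec_nonneg p x) ?_
  rw [lpVec_sum_rpow]
  have := Real.rpow_nonneg (lpVec_nonneg p (x ∘ Sum.inr)) p
  linarith

theorem lpVec_inr_le (x : ι ⊕ κ → ℂ) : lpVec p (x ∘ Sum.inr) ≤ lpVec p x := by
  refine lpVec_mono_rpow p (lpVec_nonneg p x) ?_
  rw [lpVec_sum_rpow]
  have := Real.rpow_nonneg (lpVec_nonneg p (x ∘ Sum.inl)) p
  linarith

theorem lpOpNorm_add_le (α β : Matrix ι κ ℂ) :
    lpOpNorm p (α + β) ≤ lpOpNorm p α + lpOpNorm p β := by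
  refine lpOpNorm_le p _ (add_nonneg (lpOpNorm_nonneg p _) (lpOpNorm_nonneg p _)) fun x => ?_
  rw [Matrix.add_mulVec, add_mul]
  exact (lpVec_add_le p _ _).trans (add_le_add (lpVec_mulVec_le p _ _) (lpVec_mulVec_le p _ _))

theorem lpOpNorm_smul_le (c : ℂ) (α : Matrix ι κ ℂ) :
    lpOpNorm p (c • α) ≤ ‖c‖ * lpOpNorm p α := by
  refine lpOpNorm_le p _ (mul_nonneg (norm_nonneg _) (lpOpNorm_nonneg p _)) fun x => ?_
  rw [Matrix.smul_mulVec, lpVec_smul, mul_assoc]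
  exact mul_le_mul_of_nonneg_left (lpVec_mulVec_le p _ _) (norm_nonneg _)

theorem lpOpNorm_zero : lpOpNorm p (0 : Matrix ι κ ℂ) = 0 := by
  refine le_antisymm (lpOpNorm_le p _ le_rfl fun x => ?_) (lpOpNorm_nonneg p _)
  rw [Matrix.zero_mulVec, lpVec_zero, zero_mul]

theorem lpOpNorm_mul_le (α : Matrix ι κ ℂ) (β : Matrix κ l ℂ) :
    lpOpNorm p (α * β) ≤ lpOpNorm p α * lpOpNorm p β := by
  refine lpOpNorm_le p _ (mul_nonneg (lpOpNorm_nonneg p _) (lpOpNorm_nonneg p _)) fun x => ?_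
  rw [← Matrix.mulVec_mulVec, mul_assoc]
  exact (lpVec_mulVec_le p _ _).trans
    (mul_le_mul_of_nonneg_left (lpVec_mulVec_le p _ _) (lpOpNorm_nonneg p _))

theorem lpOpNorm_one_le [DecidableEq ι] : lpOpNorm p (1 : Matrix ι ι ℂ) ≤ 1 :=
  lpOpNorm_le p _ zero_le_one fun x => by rw [Matrix.one_mulVec, one_mul]

theorem lpOpNorm_submatrix_le (α : Matrix ι κ ℂ) (e : ι' ≃ ι) (f : κ' ≃ κ) :
    lpOpNorm p (α.submatrix e f) ≤ lpOpNorm p α := by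
  refine lpOpNorm_le p _ (lpOpNorm_nonneg p _) fun x => ?_
  have h : (α.submatrix e f).mulVec x = (α.mulVec (x ∘ f.symm)) ∘ e := by
    ext i
    simp only [Matrix.mulVec, dotProduct, Matrix.submatrix_apply, Function.comp]
    rw [← Equiv.sum_comp f]
    simp
  rw [h, lpVec_comp_equiv, ← lpVec_comp_equiv p f.symm x]
  exact lpVec_mulVec_le p _ _

theorem lpOpNorm_submatrix (α : Matrix ι κ ℂ) (e : ι' ≃ ι) (f : κ' ≃ κ) :
    lpOpNorm p (α.submatrix e f) = lpOpNorm p α := by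
  refine le_antisymm (lpOpNorm_submatrix_le p α e f) ?_
  have := lpOpNorm_submatrix_le p (α.submatrix e f) e.symm f.symm
  simpa using this

theorem lpOpNorm_fromBlocks_le (α : Matrix ι κ ℂ) (β : Matrix ι' κ' ℂ) :
    lpOpNorm p (Matrix.fromBlocks α 0 0 β) ≤ max (lpOpNorm p α) (lpOpNorm p β) := by
  have hm : 0 ≤ max (lpOpNorm p α) (lpOpNorm p β) := le_max_of_le_left (lpOpNorm_nonneg p _)
  refine lpOpNorm_le p _ hm fun x => ?_
  refine lpVec_mono_rpow p (mul_nonneg hm (lpVec_nonneg p _)) ?_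
  rw [Matrix.fromBlocks_mulVec, lpVec_sum_rpow, Real.mul_rpow hm (lpVec_nonneg p _),
    lpVec_sum_rpow p x, mul_add, ← Real.mul_rpow hm (lpVec_nonneg p _),
    ← Real.mul_rpow hm (lpVec_nonneg p _)]
  simp only [Matrix.zero_mulVec, add_zero, zero_add, Sum.elim_comp_inl, Sum.elim_comp_inr]
  refine add_le_add ?_ ?_
  · exact Real.rpow_le_rpow (lpVec_nonneg p _) ((lpVec_mulVec_le p _ _).trans
      (mul_le_mul_of_nonneg_right (le_max_left _ _) (lpVec_nonneg p _))) (p_pos p).le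
  · exact Real.rpow_le_rpow (lpVec_nonneg p _) ((lpVec_mulVec_le p _ _).trans
      (mul_le_mul_of_nonneg_right (le_max_right _ _) (lpVec_nonneg p _))) (p_pos p).le

/-- A column of two blocks. -/
theorem lpOpNorm_fromRows_le (α : Matrix ι κ ℂ) (β : Matrix ι' κ ℂ) {a b : ℝ} (ha : 0 ≤ a)
    (hb : 0 ≤ b) (hα : lpOpNorm p α ≤ a ^ (1 / p)) (hβ : lpOpNorm p β ≤ b ^ (1 / p)) :
    lpOpNorm p (Matrix.fromRows α β) ≤ (a + b) ^ (1 / p) := by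
  have hp := p_pos p
  have key : ∀ c : ℝ, 0 ≤ c → (c ^ (1 / p)) ^ p = c := fun c hc => by
    rw [← Real.rpow_mul hc, one_div_mul_cancel hp.ne', Real.rpow_one]
  have hab : 0 ≤ a + b := add_nonneg ha hb
  refine lpOpNorm_le p _ (Real.rpow_nonneg hab _) fun x => ?_
  refine lpVec_mono_rpow p (mul_nonneg (Real.rpow_nonneg hab _) (lpVec_nonneg p _)) ?_
  rw [Real.mul_rpow (Real.rpow_nonneg hab _) (lpVec_nonneg p _), key _ hab, add_mul,
    Matrix.fromRows_mulVec, lpVec_sum_rpow]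
  simp only [Sum.elim_comp_inl, Sum.elim_comp_inr]
  refine add_le_add ?_ ?_
  · rw [← key a ha, ← Real.mul_rpow (Real.rpow_nonneg ha _) (lpVec_nonneg p _)]
    exact Real.rpow_le_rpow (lpVec_nonneg p _) ((lpVec_mulVec_le p _ _).trans
      (mul_le_mul_of_nonneg_right hα (lpVec_nonneg p _))) hp.le
  · rw [← key b hb, ← Real.mul_rpow (Real.rpow_nonneg hb _) (lpVec_nonneg p _)]
    exact Real.rpow_le_rpow (lpVec_nonneg p _) ((lpVec_mulVec_le p _ _).trans
      (mul_le_mul_of_nonneg_right hβ (lpVec_nonneg p _))) hp.le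

/-- A row of two blocks. -/
theorem lpOpNorm_fromCols_le (α : Matrix ι κ ℂ) (β : Matrix ι κ' ℂ) {a b : ℝ} (ha : 0 ≤ a)
    (hb : 0 ≤ b) (hα : lpOpNorm p α ≤ a ^ (1 - 1 / p)) (hβ : lpOpNorm p β ≤ b ^ (1 - 1 / p)) :
    lpOpNorm p (Matrix.fromCols α β) ≤ (a + b) ^ (1 - 1 / p) := by
  have hp : 1 < p := Fact.out
  have hpq : p.HolderConjugate (p.conjExponent) := Real.HolderConjugate.conjExponent hp
  set q := p.conjExponent with hq
  have hq1 : 1 - 1 / p = 1 / q := by have := hpq.inv_add_inv_eq_one; simp only [one_div]; linarith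
  have hq0 : 0 < q := hpq.symm.pos
  rw [hq1] at hα hβ ⊢
  have key : ∀ c : ℝ, 0 ≤ c → (c ^ (1 / q)) ^ q = c := fun c hc => by
    rw [← Real.rpow_mul hc, one_div_mul_cancel hq0.ne', Real.rpow_one]
  refine lpOpNorm_le p _ (Real.rpow_nonneg (add_nonneg ha hb) _) fun x => ?_
  have hx : lpVec p x = (lpVec p (x ∘ Sum.inl) ^ p + lpVec p (x ∘ Sum.inr) ^ p) ^ (1 / p) := by
    rw [← lpVec_sum_rpow, ← Real.rpow_mul (lpVec_nonneg p _),
      mul_one_div_cancel (p_pos p).ne', Real.rpow_one]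
  have hH := Real.inner_le_Lp_mul_Lq_of_nonneg (Finset.univ : Finset (Fin 2)) hpq.symm
    (f := ![a ^ (1 / q), b ^ (1 / q)]) (g := ![lpVec p (x ∘ Sum.inl), lpVec p (x ∘ Sum.inr)])
    (by intro i _; fin_cases i <;> simp <;> positivity)
    (by intro i _; fin_cases i <;> simp [lpVec_nonneg])
  simp only [Fin.sum_univ_two, Matrix.cons_val_zero, Matrix.cons_val_one, key a ha, key b hb] at hH
  rw [hx]
  refine le_trans ?_ hH
  rw [Matrix.fromCols_mulVec]
  refine (lpVec_add_le p _ _).trans (add_le_add ?_ ?_)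
  · exact (lpVec_mulVec_le p _ _).trans (mul_le_mul_of_nonneg_right hα (lpVec_nonneg p _))
  · exact (lpVec_mulVec_le p _ _).trans (mul_le_mul_of_nonneg_right hβ (lpVec_nonneg p _))

theorem lpOpNorm_one_by_one (α : Matrix (Fin 1) (Fin 1) ℂ) : lpOpNorm p α = ‖α 0 0‖ := by
  have h1 : ∀ x : Fin 1 → ℂ, lpVec p x = ‖x 0‖ := fun x => by
    rw [lpVec_eq, Fin.sum_univ_one, ← Real.rpow_mul (norm_nonneg _),
      mul_one_div_cancel (p_pos p).ne', Real.rpow_one]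
  refine le_antisymm (lpOpNorm_le p _ (norm_nonneg _) fun x => ?_) ?_
  · simp [h1, Matrix.mulVec, dotProduct]
  · have := lpVec_mulVec_le p α (fun _ => 1)
    simpa [h1, Matrix.mulVec, dotProduct] using this

theorem lpVec_comp_injective_le {f : ι → κ} (hf : Function.Injective f) (x : κ → ℂ) :
    lpVec p (x ∘ f) ≤ lpVec p x := by
  classical
  refine lpVec_mono_rpow p (lpVec_nonneg p x) ?_
  rw [lpVec_rpow, lpVec_rpow]
  calc ∑ i, ‖(x ∘ f) i‖ ^ p = ∑ k ∈ Finset.univ.image f, ‖x k‖ ^ p := by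
        rw [Finset.sum_image (fun a _ b _ h => hf h)]; rfl
    _ ≤ ∑ k, ‖x k‖ ^ p :=
        Finset.sum_le_sum_of_subset_of_nonneg (Finset.subset_univ _) fun k _ _ => by positivity

theorem lpOpNorm_row_le [DecidableEq κ] {f : ι → κ} (hf : Function.Injective f) :
    lpOpNorm p ((1 : Matrix κ κ ℂ).submatrix f id) ≤ 1 := by
  refine lpOpNorm_le p _ zero_le_one fun x => ?_
  have h : ((1 : Matrix κ κ ℂ).submatrix f id).mulVec x = x ∘ f := by
    ext i
    simp [Matrix.mulVec, dotProduct, Matrix.one_apply]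
  rw [h, one_mul]
  exact lpVec_comp_injective_le p hf x

theorem lpOpNorm_col_le [DecidableEq κ] {f : ι → κ} (hf : Function.Injective f) :
    lpOpNorm p ((1 : Matrix κ κ ℂ).submatrix id f) ≤ 1 := by
  refine lpOpNorm_le p _ zero_le_one fun x => ?_
  rw [one_mul]
  refine lpVec_mono_rpow p (lpVec_nonneg p x) ?_
  rw [lpVec_rpow, lpVec_rpow]
  set y := ((1 : Matrix κ κ ℂ).submatrix id f).mulVec x with hy
  have h1 : ∀ i, y (f i) = x i := fun i => by
    simp only [hy, Matrix.mulVec, dotProduct, Matrix.submatrix_apply]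
    rw [Finset.sum_eq_single i]
    · change (1 : Matrix κ κ ℂ) (f i) (f i) * x i = x i
      rw [Matrix.one_apply_eq, one_mul]
    · intro j _ hj
      change (1 : Matrix κ κ ℂ) (f i) (f j) * x j = 0
      rw [Matrix.one_apply_ne (fun h => hj (hf h.symm)), zero_mul]
    · simp
  have h2 : ∀ k, k ∉ Finset.univ.image f → y k = 0 := fun k hk => by
    have : ∀ i, k ≠ f i := fun i h => hk (by simp [h])
    simp [hy, Matrix.mulVec, dotProduct, this]
  rw [← Finset.sum_subset (Finset.subset_univ (Finset.univ.image f)) fun k _ hk => by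
    rw [h2 k hk, norm_zero, Real.zero_rpow (p_pos p).ne'],
    Finset.sum_image (fun a _ b _ h => hf h)]
  simp [h1]

theorem lpOpNorm_one_kronecker_le [DecidableEq l] (α : Matrix ι κ ℂ) :
    lpOpNorm p (Matrix.kroneckerMap (· * ·) (1 : Matrix l l ℂ) α) ≤ lpOpNorm p α := by
  refine lpOpNorm_le p _ (lpOpNorm_nonneg p _) fun x => ?_
  refine lpVec_mono_rpow p (mul_nonneg (lpOpNorm_nonneg p _) (lpVec_nonneg p _)) ?_
  have h : ∀ a i, (Matrix.kroneckerMap (· * ·) (1 : Matrix l l ℂ) α).mulVec x (a, i) =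
      α.mulVec (fun j => x (a, j)) i := fun a i => by
    simp only [Matrix.mulVec, dotProduct, Matrix.kroneckerMap_apply, Fintype.sum_prod_type]
    rw [Finset.sum_eq_single a]
    · simp
    · intro b _ hb
      simp [Ne.symm hb]
    · simp
  rw [Real.mul_rpow (lpOpNorm_nonneg p _) (lpVec_nonneg p _), lpVec_rpow, lpVec_rpow,
    Fintype.sum_prod_type, Fintype.sum_prod_type, Finset.mul_sum]
  refine Finset.sum_le_sum fun a _ => ?_
  simp only [h]
  rw [← lpVec_rpow p (α.mulVec fun j => x (a, j)), ← lpVec_rpow p (fun j => x (a, j)),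
    ← Real.mul_rpow (lpOpNorm_nonneg p _) (lpVec_nonneg p _)]
  exact Real.rpow_le_rpow (lpVec_nonneg p _) (lpVec_mulVec_le p _ _) (p_pos p).le

end LpMatrix

section Compress

variable {X : Type*} [AddCommGroup X] [Module ℂ X]
variable {ι κ ι' κ' l l' : Type*} [Fintype κ] [Fintype κ'] [Fintype l] [Fintype l']

/-- The product `α u β` of a matrix `u` over `X` with scalar matrices on both sides. -/
def compress (α : Matrix ι κ ℂ) (u : Matrix κ κ' X) (β : Matrix κ' ι' ℂ) : Matrix ι ι' X :=
  Matrix.of fun i j => ∑ k, ∑ l, (α i k * β l j) • u k l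

theorem compress_apply (α : Matrix ι κ ℂ) (u : Matrix κ κ' X) (β : Matrix κ' ι' ℂ) (i : ι)
    (j : ι') : compress α u β i j = ∑ k, ∑ l, (α i k * β l j) • u k l := rfl

theorem compress_compress (α : Matrix ι κ ℂ) (α' : Matrix κ l ℂ) (u : Matrix l l' X)
    (β' : Matrix l' κ' ℂ) (β : Matrix κ' ι' ℂ) :
    compress α (compress α' u β') β = compress (α * α') u (β' * β) := by
  ext i j
  simp only [compress_apply, Matrix.mul_apply, Finset.smul_sum, Finset.sum_mul, Finset.mul_sum,
    Finset.sum_smul, smul_smul]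
  rw [Finset.sum_congr rfl fun k _ => Finset.sum_comm]
  rw [Finset.sum_comm]
  refine Finset.sum_congr rfl fun m _ => ?_
  rw [Finset.sum_congr rfl fun k _ => Finset.sum_comm]
  rw [Finset.sum_comm]
  refine Finset.sum_congr rfl fun n _ => ?_
  rw [Finset.sum_comm]
  refine Finset.sum_congr rfl fun a _ => Finset.sum_congr rfl fun b _ => ?_
  congr 1
  ring

theorem compress_one_submatrix [DecidableEq κ] [DecidableEq κ'] (u : Matrix κ κ' X) (f : ι → κ)
    (g : ι' → κ') :
    compress ((1 : Matrix κ κ ℂ).submatrix f id) u ((1 : Matrix κ' κ' ℂ).submatrix id g) =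
      u.submatrix f g := by
  ext i j
  rw [compress_apply, Finset.sum_eq_single (f i), Finset.sum_eq_single (g j)]
  · change ((1 : Matrix κ κ ℂ) (f i) (f i) * (1 : Matrix κ' κ' ℂ) (g j) (g j)) • u (f i) (g j) = _
    rw [Matrix.one_apply_eq, Matrix.one_apply_eq, one_mul, one_smul, Matrix.submatrix_apply]
  · intro l _ hl
    simp [Matrix.one_apply, hl]
  · simp
  · intro k _ hk
    simp [Matrix.one_apply, Ne.symm hk]
  · simp

theorem compress_submatrix (α : Matrix ι κ ℂ) (u : Matrix κ κ X) (β : Matrix κ ι ℂ)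
    (e : ι' ≃ ι) (f : κ' ≃ κ) :
    compress (α.submatrix e f) (u.submatrix f f) (β.submatrix f e) =
      (compress α u β).submatrix e e := by
  ext i j
  simp only [compress_apply, Matrix.submatrix_apply]
  rw [Equiv.sum_comp f (fun k => ∑ l, (α (e i) k * β (f l) (e j)) • u k (f l))]
  refine Finset.sum_congr rfl fun k _ => ?_
  rw [Equiv.sum_comp f (fun l => (α (e i) k * β l (e j)) • u k l)]

theorem compress_map {Y : Type*} [AddCommGroup Y] [Module ℂ Y] (φ : X →ₗ[ℂ] Y)
    (α : Matrix ι κ ℂ) (u : Matrix κ κ' X) (β : Matrix κ' ι' ℂ) :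
    (compress α u β).map φ = compress α (u.map φ) β := by
  ext i j
  simp [compress_apply]

theorem compress_zero_left (u : Matrix κ κ' X) (β : Matrix κ' ι' ℂ) :
    compress (0 : Matrix ι κ ℂ) u β = 0 := by
  ext i j
  simp [compress_apply]

theorem compress_add (α : Matrix ι κ ℂ) (u v : Matrix κ κ' X) (β : Matrix κ' ι' ℂ) :
    compress α (u + v) β = compress α u β + compress α v β := by
  ext i j
  simp [compress_apply, Finset.sum_add_distrib]

theorem compress_smul_one [DecidableEq κ] [DecidableEq κ'] (c : ℂ) (u : Matrix κ κ' X) :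
    compress (c • (1 : Matrix κ κ ℂ)) u (1 : Matrix κ' κ' ℂ) = c • u := by
  have h := compress_one_submatrix u id id
  simp only [Matrix.submatrix_id_id] at h
  conv_rhs => rw [← h]
  ext i j
  simp [compress_apply, Finset.smul_sum, smul_smul, mul_assoc]

theorem compress_fromCols_fromRows {m m' : Type*} [Fintype m] [Fintype m'] (α : Matrix ι κ ℂ)
    (α' : Matrix ι m ℂ) (u : Matrix κ κ' X) (u' : Matrix m m' X) (β : Matrix κ' ι' ℂ)
    (β' : Matrix m' ι' ℂ) :
    compress (Matrix.fromCols α α') (Matrix.fromBlocks u 0 0 u') (Matrix.fromRows β β') =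
      compress α u β + compress α' u' β' := by
  ext i j
  simp [compress_apply]

theorem compress_fromBlocks {m m' : Type*} [Fintype m] [Fintype m'] (α : Matrix ι κ ℂ)
    (α' : Matrix l m ℂ) (u : Matrix κ κ' X) (u' : Matrix m m' X) (β : Matrix κ' ι' ℂ)
    (β' : Matrix m' l' ℂ) :
    compress (Matrix.fromBlocks α 0 0 α') (Matrix.fromBlocks u 0 0 u')
      (Matrix.fromBlocks β 0 0 β') =
      Matrix.fromBlocks (compress α u β) 0 0 (compress α' u' β') := by
  ext i j
  rcases i with i | i <;> rcases j with j | j <;> simp [compress_apply]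

end Compress

/-- A `p`-operator space structure on a complex (semi)normed space `X`: for every `n` a norm on the
`n × n` matrices over `X`, agreeing with the given norm for `n = 1`, such that the axioms
`𝓓_∞` and `𝓜_p` hold. When `X` is normed (not just seminormed) each `mnorm n` is a norm, see
`eq_zero_of_mnorm`; a `p`-operator space is a Banach space with such a structure. -/
class POperatorStructure (p : ℝ) [Fact (1 < p)] (X : Type*) [SeminormedAddCommGroup X]
    [NormedSpace ℂ X] where
  mnorm (n : ℕ) : Seminorm ℂ (Matrix (Fin n) (Fin n) X)
  mnorm_one (u : Matrix (Fin 1) (Fin 1) X) : mnorm 1 u = ‖u 0 0‖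
  mnorm_directSum {n m : ℕ} (u : Matrix (Fin n) (Fin n) X) (v : Matrix (Fin m) (Fin m) X) :
    mnorm (n + m) (Matrix.reindex finSumFinEquiv finSumFinEquiv (Matrix.fromBlocks u 0 0 v)) =
      max (mnorm n u) (mnorm m v)
  mnorm_compress {n m : ℕ} (α : Matrix (Fin n) (Fin m) ℂ) (u : Matrix (Fin m) (Fin m) X)
    (β : Matrix (Fin m) (Fin n) ℂ) :
    mnorm n (compress α u β) ≤ lpOpNorm p α * mnorm m u * lpOpNorm p β



section Basic

variable (p : ℝ) [Fact (1 < p)] {X : Type*} [SeminormedAddCommGroup X] [NormedSpace ℂ X]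
  [POperatorStructure p X]
variable {ι κ : Type*} [Fintype ι] [Fintype κ]

/-- The norm of a matrix indexed by an arbitrary finite type, through an enumeration of the index
type (the choice does not matter, see `fnorm_eq`). -/
noncomputable def fnorm (u : Matrix ι ι X) : ℝ :=
  POperatorStructure.mnorm p (Fintype.card ι)
    (Matrix.reindex (Fintype.equivFin ι) (Fintype.equivFin ι) u)

theorem fnorm_nonneg (u : Matrix ι ι X) : 0 ≤ fnorm p u := apply_nonneg _ _

theorem fnorm_add_le (u v : Matrix ι ι X) : fnorm p (u + v) ≤ fnorm p u + fnorm p v :=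
  map_add_le_add (POperatorStructure.mnorm p (Fintype.card ι)) _ _

theorem fnorm_zero : fnorm p (0 : Matrix ι ι X) = 0 :=
  map_zero (POperatorStructure.mnorm (X := X) p (Fintype.card ι))

theorem fnorm_smul (c : ℂ) (u : Matrix ι ι X) : fnorm p (c • u) = ‖c‖ * fnorm p u :=
  map_smul_eq_mul (POperatorStructure.mnorm (X := X) p (Fintype.card ι)) c _

theorem fnorm_compress_le (α : Matrix ι κ ℂ) (u : Matrix κ κ X) (β : Matrix κ ι ℂ) :
    fnorm p (compress α u β) ≤ lpOpNorm p α * fnorm p u * lpOpNorm p β := by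
  have h := POperatorStructure.mnorm_compress (p := p)
    (α.submatrix (Fintype.equivFin ι).symm (Fintype.equivFin κ).symm)
    (u.submatrix (Fintype.equivFin κ).symm (Fintype.equivFin κ).symm)
    (β.submatrix (Fintype.equivFin κ).symm (Fintype.equivFin ι).symm)
  rw [compress_submatrix, lpOpNorm_submatrix, lpOpNorm_submatrix] at h
  exact h

theorem mnorm_submatrix_le {n m : ℕ} (u : Matrix (Fin m) (Fin m) X) {f g : Fin n → Fin m}
    (hf : Function.Injective f) (hg : Function.Injective g) :
    POperatorStructure.mnorm p n (u.submatrix f g) ≤ POperatorStructure.mnorm p m u := by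
  rw [← compress_one_submatrix]
  refine (POperatorStructure.mnorm_compress _ _ _).trans ?_
  have h0 : 0 ≤ POperatorStructure.mnorm p m u := apply_nonneg _ _
  have h1 := lpOpNorm_row_le p hf
  have h2 := lpOpNorm_col_le p hg
  have h3 := lpOpNorm_nonneg p ((1 : Matrix (Fin m) (Fin m) ℂ).submatrix id g)
  calc _ ≤ 1 * POperatorStructure.mnorm p m u * 1 := by gcongr
    _ = _ := by ring

theorem fnorm_submatrix_le (u : Matrix κ κ X) {f g : ι → κ} (hf : Function.Injective f)
    (hg : Function.Injective g) : fnorm p (u.submatrix f g) ≤ fnorm p u := by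
  have := mnorm_submatrix_le p (Matrix.reindex (Fintype.equivFin κ) (Fintype.equivFin κ) u)
    (f := Fintype.equivFin κ ∘ f ∘ (Fintype.equivFin ι).symm)
    (g := Fintype.equivFin κ ∘ g ∘ (Fintype.equivFin ι).symm)
    ((Fintype.equivFin κ).injective.comp (hf.comp (Fintype.equivFin ι).symm.injective))
    ((Fintype.equivFin κ).injective.comp (hg.comp (Fintype.equivFin ι).symm.injective))
  refine le_trans (le_of_eq ?_) this
  unfold fnorm
  congr 1
  ext i j
  simp

theorem fnorm_submatrix (u : Matrix κ κ X) (f : ι ≃ κ) :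
    fnorm p (u.submatrix f f) = fnorm p u := by
  refine le_antisymm (fnorm_submatrix_le p u f.injective f.injective) ?_
  have := fnorm_submatrix_le p (u.submatrix f f) f.symm.injective f.symm.injective
  simpa using this

/-- Independence of the enumeration. -/
theorem fnorm_eq {n : ℕ} (u : Matrix ι ι X) (e : Fin n ≃ ι) :
    fnorm p u = POperatorStructure.mnorm p n (u.submatrix e e) := by
  refine le_antisymm ?_ ?_
  · have := mnorm_submatrix_le p (u.submatrix e e)
      ((Fintype.equivFin ι).symm.trans e.symm).injective
      ((Fintype.equivFin ι).symm.trans e.symm).injective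
    refine le_trans (le_of_eq ?_) this
    unfold fnorm
    congr 1
    ext i j
    simp
  · have := mnorm_submatrix_le p (Matrix.reindex (Fintype.equivFin ι) (Fintype.equivFin ι) u)
      (e.trans (Fintype.equivFin ι)).injective (e.trans (Fintype.equivFin ι)).injective
    refine le_trans (le_of_eq ?_) this
    congr 1
    ext i j
    simp

theorem fnorm_fin {n : ℕ} (u : Matrix (Fin n) (Fin n) X) :
    fnorm p u = POperatorStructure.mnorm p n u := fnorm_eq p u (Equiv.refl _)

theorem fnorm_fromBlocks (u : Matrix ι ι X) (v : Matrix κ κ X) :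
    fnorm p (Matrix.fromBlocks u 0 0 v) = max (fnorm p u) (fnorm p v) := by
  let e := Fintype.equivFin ι
  let f := Fintype.equivFin κ
  have h := POperatorStructure.mnorm_directSum (p := p) (Matrix.reindex e e u)
    (Matrix.reindex f f v)
  rw [fnorm_eq p (Matrix.fromBlocks u 0 0 v) (finSumFinEquiv.symm.trans (Equiv.sumCongr e f).symm)]
  refine Eq.trans ?_ h
  congr 1
  ext i j
  rcases h1 : finSumFinEquiv.symm i with a | a <;> rcases h2 : finSumFinEquiv.symm j with b | b <;>
    simp [h1, h2]

theorem fnorm_fin_one (u : Matrix (Fin 1) (Fin 1) X) : fnorm p u = ‖u 0 0‖ := by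
  rw [fnorm_fin, POperatorStructure.mnorm_one]

theorem fnorm_unique [Unique ι] (u : Matrix ι ι X) : fnorm p u = ‖u default default‖ := by
  rw [fnorm_eq p u (Equiv.ofUnique (Fin 1) ι), POperatorStructure.mnorm_one]
  simp

/-- Each entry is dominated by the norm of the matrix. -/
theorem norm_entry_le_fnorm (u : Matrix ι ι X) (i j : ι) : ‖u i j‖ ≤ fnorm p u := by
  have := fnorm_submatrix_le p u (f := fun _ : Fin 1 => i) (g := fun _ => j)
    (Function.injective_of_subsingleton _) (Function.injective_of_subsingleton _)
  rwa [fnorm_fin_one] at this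

theorem fnorm_single_le [DecidableEq ι] (i j : ι) (x : X) :
    fnorm p (Matrix.single i j x) ≤ ‖x‖ := by
  have h : Matrix.single i j x = compress ((1 : Matrix ι ι ℂ).submatrix id (fun _ : Fin 1 => i))
      (Matrix.of fun _ _ => x) ((1 : Matrix ι ι ℂ).submatrix (fun _ : Fin 1 => j) id) := by
    ext k l
    simp [compress_apply, Matrix.single_apply, Matrix.one_apply, ← ite_and, eq_comm, and_comm]
  rw [h]
  refine (fnorm_compress_le p _ _ _).trans ?_
  have h1 := lpOpNorm_col_le p (f := fun _ : Fin 1 => i) (Function.injective_of_subsingleton _)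
  have h2 := lpOpNorm_row_le p (f := fun _ : Fin 1 => j) (Function.injective_of_subsingleton _)
  have h3 := lpOpNorm_nonneg p ((1 : Matrix ι ι ℂ).submatrix (fun _ : Fin 1 => j) id)
  rw [fnorm_fin_one]
  calc _ ≤ 1 * ‖x‖ * 1 := by gcongr; simp
    _ = _ := by ring

theorem fnorm_sum_le {σ : Type*} (s : Finset σ) (u : σ → Matrix ι ι X) :
    fnorm p (∑ k ∈ s, u k) ≤ ∑ k ∈ s, fnorm p (u k) :=
  Finset.le_sum_of_subadditive _ (fnorm_zero p).le (fnorm_add_le p) s u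

theorem fnorm_le_sum (u : Matrix ι ι X) : fnorm p u ≤ ∑ i, ∑ j, ‖u i j‖ := by
  classical
  conv_lhs => rw [Matrix.matrix_eq_sum_single u]
  refine (fnorm_sum_le p _ _).trans (Finset.sum_le_sum fun i _ => ?_)
  refine (fnorm_sum_le p _ _).trans (Finset.sum_le_sum fun j _ => ?_)
  exact fnorm_single_le p i j _

theorem continuous_mnorm (n : ℕ) :
    Continuous fun A : Matrix (Fin n) (Fin n) X => POperatorStructure.mnorm p n A := by
  refine continuous_iff_continuousAt.2 fun A => ?_
  have hc : Continuous fun B : Matrix (Fin n) (Fin n) X => ∑ i, ∑ j, ‖B i j - A i j‖ := by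
    refine continuous_finsetSum _ fun i _ => continuous_finsetSum _ fun j _ => ?_
    exact ((continuous_id.matrix_elem i j).sub continuous_const).norm
  have h0 := hc.tendsto A
  simp only [sub_self, norm_zero, Finset.sum_const_zero] at h0
  refine tendsto_iff_norm_sub_tendsto_zero.2 (squeeze_zero (fun _ => norm_nonneg _) (fun B => ?_) h0)
  refine (abs_sub_map_le_sub (POperatorStructure.mnorm (X := X) p n) B A).trans ?_
  rw [← fnorm_fin]
  exact fnorm_le_sum p (B - A)

end Basic

theorem eq_zero_of_mnorm (p : ℝ) [Fact (1 < p)] {X : Type*} [NormedAddCommGroup X]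
    [NormedSpace ℂ X] [POperatorStructure p X] {n : ℕ} (u : Matrix (Fin n) (Fin n) X)
    (hu : POperatorStructure.mnorm p n u = 0) : u = 0 := by
  ext i j
  have := norm_entry_le_fnorm p u i j
  rw [fnorm_fin, hu] at this
  simpa using this

section Mk

variable (p : ℝ) [Fact (1 < p)] {X : Type*} [SeminormedAddCommGroup X] [NormedSpace ℂ X]

/-- A family of functions that satisfies the axioms up to the automatic parts. -/
noncomputable abbrev POperatorStructure.ofBounds (N : (n : ℕ) → Matrix (Fin n) (Fin n) X → ℝ)
    (nonneg : ∀ n u, 0 ≤ N n u) (add_le : ∀ n u v, N n (u + v) ≤ N n u + N n v)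
    (one : ∀ u, N 1 u = ‖u 0 0‖)
    (directSum_le : ∀ {n m : ℕ} (u : Matrix (Fin n) (Fin n) X) (v : Matrix (Fin m) (Fin m) X),
      N (n + m) (Matrix.reindex finSumFinEquiv finSumFinEquiv (Matrix.fromBlocks u 0 0 v)) ≤
        max (N n u) (N m v))
    (compress_le : ∀ {n m : ℕ} (α : Matrix (Fin n) (Fin m) ℂ) (u : Matrix (Fin m) (Fin m) X)
      (β : Matrix (Fin m) (Fin n) ℂ),
      N n (compress α u β) ≤ lpOpNorm p α * N m u * lpOpNorm p β) :
    POperatorStructure p X where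
  mnorm n := Seminorm.ofSMulLE (N n)
    (by
      refine le_antisymm ?_ (nonneg _ _)
      have h := compress_le (0 : Matrix (Fin n) (Fin n) ℂ) (0 : Matrix (Fin n) (Fin n) X) 0
      rwa [compress_zero_left, lpOpNorm_zero, zero_mul, zero_mul] at h)
    (add_le n)
    (fun c u => by
      have h := compress_le (c • (1 : Matrix (Fin n) (Fin n) ℂ)) u 1
      rw [compress_smul_one] at h
      have h1 := lpOpNorm_one_le (ι := Fin n) p
      have h2 := (lpOpNorm_smul_le p c (1 : Matrix (Fin n) (Fin n) ℂ)).trans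
        (mul_le_of_le_one_right (norm_nonneg c) h1)
      have h3 := lpOpNorm_nonneg p (1 : Matrix (Fin n) (Fin n) ℂ)
      have h4 := nonneg n u
      calc _ ≤ _ := h
        _ ≤ ‖c‖ * N n u * 1 := by gcongr
        _ = _ := by ring)
  mnorm_one := one
  mnorm_directSum {n m} u v := by
    refine le_antisymm (directSum_le u v) ?_
    set U := Matrix.reindex finSumFinEquiv finSumFinEquiv (Matrix.fromBlocks u 0 0 v) with hU
    have key : ∀ {k : ℕ} (f : Fin k → Fin (n + m)), Function.Injective f →
        N k (U.submatrix f f) ≤ N (n + m) U := fun {k} f hf => by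
      rw [← compress_one_submatrix]
      refine (compress_le _ _ _).trans ?_
      have h0 := nonneg _ U
      have h1 := lpOpNorm_row_le p hf
      have h2 := lpOpNorm_col_le p hf
      have h3 := lpOpNorm_nonneg p
        ((1 : Matrix (Fin (n + m)) (Fin (n + m)) ℂ).submatrix id f)
      calc _ ≤ 1 * N (n + m) U * 1 := by gcongr
        _ = _ := by ring
    refine max_le ?_ ?_
    · have h := key (finSumFinEquiv ∘ Sum.inl) (finSumFinEquiv.injective.comp Sum.inl_injective)
      refine le_trans (le_of_eq ?_) h
      change N n u = _
      congr 1
      ext i j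
      simp [hU]
    · have h := key (finSumFinEquiv ∘ Sum.inr) (finSumFinEquiv.injective.comp Sum.inr_injective)
      refine le_trans (le_of_eq ?_) h
      change N m v = _
      congr 1
      ext i j
      simp [hU]
  mnorm_compress := compress_le

theorem mnorm_directSum_le_of_le [POperatorStructure p X] {ι κ : Type*} [Fintype ι] [Fintype κ]
    (u : Matrix ι ι X) (v : Matrix κ κ X) {C : ℝ} (hu : fnorm p u ≤ C) (hv : fnorm p v ≤ C) :
    fnorm p (Matrix.fromBlocks u 0 0 v) ≤ C := by
  rw [fnorm_fromBlocks]
  exact max_le hu hv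

end Mk

/-- `M_n(ℂ)` is normed as `𝓑(ℓ_p^n)`. -/
noncomputable instance instComplex (p : ℝ) [Fact (1 < p)] : POperatorStructure p ℂ :=
  POperatorStructure.ofBounds p (fun _ u => lpOpNorm p u) (fun _ u => lpOpNorm_nonneg p u)
    (fun _ u v => lpOpNorm_add_le p u v) (lpOpNorm_one_by_one p)
    (fun u v => by
      rw [Matrix.reindex_apply, lpOpNorm_submatrix]
      exact lpOpNorm_fromBlocks_le p u v)
    (fun α u β => by
      have h : compress α u β = α * u * β := by
        ext i j
        simp only [compress_apply, Matrix.mul_apply, Finset.sum_mul, smul_eq_mul]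
        rw [Finset.sum_comm]
        refine Finset.sum_congr rfl fun a _ => Finset.sum_congr rfl fun b _ => ?_
        ring
      rw [h]
      exact (lpOpNorm_mul_le p _ _).trans
        (mul_le_mul_of_nonneg_right (lpOpNorm_mul_le p _ _) (lpOpNorm_nonneg p _)))

/-- A linear subspace with the inherited matrix norms. -/
noncomputable instance instSubmodule (p : ℝ) [Fact (1 < p)] {X : Type*} [SeminormedAddCommGroup X]
    [NormedSpace ℂ X] [POperatorStructure p X] (S : Submodule ℂ X) : POperatorStructure p S :=
  POperatorStructure.ofBounds p
    (fun n u => POperatorStructure.mnorm p n (u.map S.subtype))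
    (fun _ _ => apply_nonneg _ _)
    (fun n u v => by
      rw [Matrix.map_add _ (map_add _)]
      exact map_add_le_add _ _ _)
    (fun u => POperatorStructure.mnorm_one _)
    (fun u v => by
      rw [← POperatorStructure.mnorm_directSum]
      refine le_of_eq (congrArg _ ?_)
      rw [Matrix.reindex_apply, Matrix.reindex_apply, ← Matrix.submatrix_map,
        Matrix.fromBlocks_map, Matrix.map_zero _ (map_zero _), Matrix.map_zero _ (map_zero _)])
    (fun α u β => by
      rw [compress_map]
      exact POperatorStructure.mnorm_compress _ _ _)

section CB

variable (p : ℝ) [Fact (1 < p)] {X : Type*} [SeminormedAddCommGroup X] [NormedSpace ℂ X]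
  [POperatorStructure p X] {Y : Type*} [SeminormedAddCommGroup Y] [NormedSpace ℂ Y]
  [POperatorStructure p Y]

/-- `u : X → Y` satisfies `‖u_n‖ ≤ C` for all `n`, where `u_n : M_n(X) → M_n(Y)` is `u` applied
entrywise. -/
def PCBBound (u : X →ₗ[ℂ] Y) (C : ℝ) : Prop :=
  ∀ (n : ℕ) (A : Matrix (Fin n) (Fin n) X),
    POperatorStructure.mnorm p n (A.map u) ≤ C * POperatorStructure.mnorm p n A

/-- `p`-completely contractive maps. -/
def IsPCompletelyContractive (u : X →ₗ[ℂ] Y) : Prop := PCBBound p u 1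

/-- For `F` in `M_ι(Hom(X, Y))`, regarded as the map `X → M_ι(Y)`, `x ↦ [F_{st}(x)]`, and a
matrix `A` over `X`: the matrix over `Y` obtained by applying that map to the entries of `A`. -/
def amplify {ι κ : Type*} (F : Matrix ι ι (X →ₗ[ℂ] Y)) (A : Matrix κ κ X) :
    Matrix (κ × ι) (κ × ι) Y :=
  Matrix.of fun a b => F a.2 b.2 (A a.1 b.1)

/-- The bound `‖F‖ ≤ C` in `CB_p(X, M_ι(Y))`, where `M_k(M_ι(Y)) = M_{k × ι}(Y)`. -/
def MatPCBBound {ι : Type*} [Fintype ι] (F : Matrix ι ι (X →ₗ[ℂ] Y)) (C : ℝ) : Prop :=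
  ∀ (k : ℕ) (A : Matrix (Fin k) (Fin k) X),
    fnorm p (amplify F A) ≤ C * POperatorStructure.mnorm p k A

theorem amplify_fin_one (F : Matrix (Fin 1) (Fin 1) (X →ₗ[ℂ] Y)) {k : ℕ}
    (A : Matrix (Fin k) (Fin k) X) :
    fnorm p (amplify F A) = POperatorStructure.mnorm p k (A.map (F 0 0)) := by
  rw [← fnorm_fin, ← fnorm_submatrix p _ (Equiv.prodUnique (Fin k) (Fin 1))]
  congr 1
  ext a b
  simp [amplify, Subsingleton.elim a.2 0, Subsingleton.elim b.2 0]

theorem matPCBBound_fin_one (F : Matrix (Fin 1) (Fin 1) (X →ₗ[ℂ] Y)) (C : ℝ) :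
    MatPCBBound p F C ↔ PCBBound p (F 0 0) C := by
  simp only [MatPCBBound, PCBBound, amplify_fin_one]

theorem exists_matPCBBound {ι : Type*} [Fintype ι] (F : Matrix ι ι (X →ₗ[ℂ] Y))
    (hF : ∀ s t, ∃ C, 0 ≤ C ∧ PCBBound p (F s t) C) : ∃ C, 0 ≤ C ∧ MatPCBBound p F C := by
  classical
  choose C hC0 hC using hF
  refine ⟨∑ s, ∑ t, C s t, Finset.sum_nonneg fun s _ => Finset.sum_nonneg fun t _ => hC0 s t,
    fun k A => ?_⟩
  have h : amplify F A = ∑ s, ∑ t,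
      compress ((1 : Matrix (Fin k × ι) (Fin k × ι) ℂ).submatrix id fun i : Fin k => (i, s))
        (A.map (F s t)) ((1 : Matrix (Fin k × ι) (Fin k × ι) ℂ).submatrix
          (fun i : Fin k => (i, t)) id) := by
    ext ⟨a, s⟩ ⟨b, t⟩
    simp only [Matrix.sum_apply, compress_apply, Matrix.submatrix_apply, id, Matrix.one_apply,
      Prod.mk.injEq]
    rw [Finset.sum_eq_single s, Finset.sum_eq_single t, Finset.sum_eq_single a,
      Finset.sum_eq_single b]
    · simp [amplify]
    · intro j _ hj; simp [hj]
    · simp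
    · intro i _ hi; simp [Ne.symm hi]
    · simp
    · intro t' _ ht; simp [ht]
    · simp
    · intro s' _ hs; simp [Ne.symm hs]
    · simp
  rw [h, Finset.sum_mul]
  refine (fnorm_sum_le p _ _).trans (Finset.sum_le_sum fun s _ => ?_)
  rw [Finset.sum_mul]
  refine (fnorm_sum_le p _ _).trans (Finset.sum_le_sum fun t _ => ?_)
  refine (fnorm_compress_le p _ _ _).trans ?_
  have hi : ∀ s : ι, Function.Injective fun i : Fin k => (i, s) := fun s a b hab => by
    simpa using hab
  have h1 := lpOpNorm_col_le p (hi s)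
  have h2 := lpOpNorm_row_le p (hi t)
  have h3 := lpOpNorm_nonneg p ((1 : Matrix (Fin k × ι) (Fin k × ι) ℂ).submatrix
          (fun i : Fin k => (i, t)) id)
  have h4 := fnorm_nonneg p (A.map (F s t))
  calc _ ≤ 1 * fnorm p (A.map (F s t)) * 1 := by gcongr
    _ = fnorm p (A.map (F s t)) := by ring
    _ ≤ _ := by rw [fnorm_fin]; exact hC s t k A

/-- The norm of `CB_p(X, M_ι(Y))`. -/
noncomputable def matPCBNorm {ι : Type*} [Fintype ι] (F : Matrix ι ι (X →ₗ[ℂ] Y)) : ℝ :=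
  sInf {C : ℝ | 0 ≤ C ∧ MatPCBBound p F C}

theorem matPCBNorm_nonneg {ι : Type*} [Fintype ι] (F : Matrix ι ι (X →ₗ[ℂ] Y)) :
    0 ≤ matPCBNorm p F := Real.sInf_nonneg fun _ h => h.1

theorem matPCBNorm_le {ι : Type*} [Fintype ι] (F : Matrix ι ι (X →ₗ[ℂ] Y)) {C : ℝ} (hC : 0 ≤ C)
    (h : MatPCBBound p F C) : matPCBNorm p F ≤ C := csInf_le ⟨0, fun _ h => h.1⟩ ⟨hC, h⟩

theorem le_mul_csInf {S : Set ℝ} (hS : S.Nonempty) {x k : ℝ} (hk : 0 ≤ k)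
    (h : ∀ c ∈ S, x ≤ k * c) : x ≤ k * sInf S := by
  rcases hk.eq_or_lt with rfl | hk
  · obtain ⟨c, hc⟩ := hS
    simpa using h c hc
  · rw [← div_le_iff₀' hk]
    exact le_csInf hS fun c hc => by rw [div_le_iff₀' hk]; exact h c hc

theorem matPCBBound_norm {ι : Type*} [Fintype ι] (F : Matrix ι ι (X →ₗ[ℂ] Y))
    (hF : ∀ s t, ∃ C, 0 ≤ C ∧ PCBBound p (F s t) C) : MatPCBBound p F (matPCBNorm p F) := by
  intro k A
  rw [mul_comm]
  exact le_mul_csInf (exists_matPCBBound p F hF) (apply_nonneg _ _) fun c hc => by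
    rw [mul_comm]; exact hc.2 k A

theorem matPCBBound_add {ι : Type*} [Fintype ι] {F G : Matrix ι ι (X →ₗ[ℂ] Y)} {C D : ℝ}
    (hF : MatPCBBound p F C) (hG : MatPCBBound p G D) : MatPCBBound p (F + G) (C + D) := by
  intro k A
  have h : amplify (F + G) A = amplify F A + amplify G A := by ext; simp [amplify]
  rw [h, add_mul]
  exact (fnorm_add_le p _ _).trans (add_le_add (hF k A) (hG k A))

theorem matPCBBound_compress {ι κ : Type*} [Fintype ι] [Fintype κ] (α : Matrix ι κ ℂ)
    {F : Matrix κ κ (X →ₗ[ℂ] Y)} (β : Matrix κ ι ℂ) {C : ℝ} (hC : 0 ≤ C)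
    (hF : MatPCBBound p F C) :
    MatPCBBound p (compress α F β) (lpOpNorm p α * C * lpOpNorm p β) := by
  intro k A
  have h : amplify (compress α F β) A =
      compress (Matrix.kroneckerMap (· * ·) (1 : Matrix (Fin k) (Fin k) ℂ) α) (amplify F A)
        (Matrix.kroneckerMap (· * ·) (1 : Matrix (Fin k) (Fin k) ℂ) β) := by
    ext ⟨a, i⟩ ⟨b, j⟩
    simp only [amplify, Matrix.of_apply, compress_apply, Matrix.kroneckerMap_apply,
      Fintype.sum_prod_type, LinearMap.sum_apply, LinearMap.smul_apply]
    rw [Finset.sum_eq_single a]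
    · refine Finset.sum_congr rfl fun s _ => ?_
      rw [Finset.sum_eq_single b]
      · simp
      · intro b' _ hb; simp [hb]
      · simp
    · intro a' _ ha; simp [Matrix.one_apply, Ne.symm ha]
    · simp
  rw [h]
  refine (fnorm_compress_le p _ _ _).trans ?_
  have h0 : 0 ≤ POperatorStructure.mnorm p k A := apply_nonneg _ _
  have h1 := lpOpNorm_one_kronecker_le (l := Fin k) p α
  have h2 := lpOpNorm_one_kronecker_le (l := Fin k) p β
  have h3 := lpOpNorm_nonneg p α
  have h4 := fnorm_nonneg p (amplify F A)
  have h5 := lpOpNorm_nonneg p (Matrix.kroneckerMap (· * ·) (1 : Matrix (Fin k) (Fin k) ℂ) β)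
  calc _ ≤ lpOpNorm p α * (C * POperatorStructure.mnorm p k A) * lpOpNorm p β := by
        gcongr; exact hF k A
    _ = _ := by ring

theorem matPCBBound_directSum {n m : ℕ} {F : Matrix (Fin n) (Fin n) (X →ₗ[ℂ] Y)}
    {G : Matrix (Fin m) (Fin m) (X →ₗ[ℂ] Y)} {C : ℝ} (hF : MatPCBBound p F C)
    (hG : MatPCBBound p G C) : MatPCBBound p
      (Matrix.reindex finSumFinEquiv finSumFinEquiv (Matrix.fromBlocks F 0 0 G)) C := by
  intro k A
  have h : amplify (Matrix.reindex finSumFinEquiv finSumFinEquiv (Matrix.fromBlocks F 0 0 G)) A =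
      (Matrix.fromBlocks (amplify F A) 0 0 (amplify G A)).submatrix
        ((Equiv.prodCongr (Equiv.refl _) finSumFinEquiv.symm).trans (Equiv.prodSumDistrib _ _ _))
        ((Equiv.prodCongr (Equiv.refl _) finSumFinEquiv.symm).trans
          (Equiv.prodSumDistrib _ _ _)) := by
    ext ⟨a, i⟩ ⟨b, j⟩
    rcases h1 : finSumFinEquiv.symm i with s | s <;>
      rcases h2 : finSumFinEquiv.symm j with t | t <;> simp [amplify, h1, h2]
  rw [h, fnorm_submatrix]
  exact mnorm_directSum_le_of_le p _ _ (hF k A) (hG k A)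

end CB

section CBSpace

variable (p : ℝ) [Fact (1 < p)] (X : Type*) [SeminormedAddCommGroup X] [NormedSpace ℂ X]
  [POperatorStructure p X] (Y : Type*) [NormedAddCommGroup Y] [NormedSpace ℂ Y]
  [POperatorStructure p Y]

/-- The `p`-completely bounded maps, as a subspace of the space of linear maps. -/
def cbSubmodule : Submodule ℂ (X →ₗ[ℂ] Y) where
  carrier := {u | ∃ C, 0 ≤ C ∧ PCBBound p u C}
  zero_mem' := ⟨0, le_rfl, fun n A => by
    have h : A.map (0 : X →ₗ[ℂ] Y) = 0 := by ext; simp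
    rw [h, map_zero, zero_mul]⟩
  add_mem' := by
    rintro u v ⟨C, hC0, hC⟩ ⟨D, hD0, hD⟩
    refine ⟨C + D, add_nonneg hC0 hD0, fun n A => ?_⟩
    have h : A.map (u + v : X →ₗ[ℂ] Y) = A.map u + A.map v := by ext; simp
    rw [h, add_mul]
    exact (map_add_le_add _ _ _).trans (add_le_add (hC n A) (hD n A))
  smul_mem' := by
    rintro c u ⟨C, hC0, hC⟩
    refine ⟨‖c‖ * C, mul_nonneg (norm_nonneg _) hC0, fun n A => ?_⟩
    have h : A.map (c • u : X →ₗ[ℂ] Y) = c • A.map u := by ext; simp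
    rw [h, map_smul_eq_mul, mul_assoc]
    exact mul_le_mul_of_nonneg_left (hC n A) (norm_nonneg _)

/-- The space `CB_p(X, Y)` of `p`-completely bounded maps. -/
def CB : Type _ := cbSubmodule p X Y

noncomputable instance : AddCommGroup (CB p X Y) :=
  inferInstanceAs (AddCommGroup (cbSubmodule p X Y))
noncomputable instance : Module ℂ (CB p X Y) := inferInstanceAs (Module ℂ (cbSubmodule p X Y))

namespace CB

variable {p X Y}

/-- The underlying linear map. -/
noncomputable def toLin : CB p X Y →ₗ[ℂ] X →ₗ[ℂ] Y := (cbSubmodule p X Y).subtype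

noncomputable instance : CoeFun (CB p X Y) fun _ => X → Y := ⟨fun u => toLin u⟩

/-- A linear map with a bound, as an element of `CB_p(X, Y)`. -/
def mk (u : X →ₗ[ℂ] Y) (h : ∃ C, 0 ≤ C ∧ PCBBound p u C) : CB p X Y :=
  (⟨u, h⟩ : cbSubmodule p X Y)

theorem toLin_mk (u : X →ₗ[ℂ] Y) (h : ∃ C, 0 ≤ C ∧ PCBBound p u C) : toLin (mk u h) = u := rfl

theorem toLin_injective : Function.Injective (toLin : CB p X Y → X →ₗ[ℂ] Y) :=
  Subtype.val_injective

theorem exists_bound (u : CB p X Y) : ∃ C, 0 ≤ C ∧ PCBBound p (toLin u) C := u.2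

/-- `‖u‖_pcb = sup_n ‖u_n‖`, the least common bound of the maps `u_n`. -/
noncomputable instance : Norm (CB p X Y) :=
  ⟨fun u => sInf {C : ℝ | 0 ≤ C ∧ PCBBound p (toLin u) C}⟩

theorem norm_def (u : CB p X Y) : ‖u‖ = sInf {C : ℝ | 0 ≤ C ∧ PCBBound p (toLin u) C} := rfl

theorem norm_eq_mat (u : CB p X Y) :
    ‖u‖ = matPCBNorm p (Matrix.of fun _ _ : Fin 1 => toLin u) := by
  simp only [norm_def, matPCBNorm, matPCBBound_fin_one, Matrix.of_apply]

theorem mat_bound {ι : Type*} [Fintype ι] (F : Matrix ι ι (CB p X Y)) :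
    MatPCBBound p (F.map toLin) (matPCBNorm p (F.map toLin)) :=
  matPCBBound_norm p _ fun s t => exists_bound (F s t)

theorem norm_nonneg' (u : CB p X Y) : 0 ≤ ‖u‖ := Real.sInf_nonneg fun _ h => h.1

theorem pcbBound_norm (u : CB p X Y) : PCBBound p (toLin u) ‖u‖ := by
  rw [norm_eq_mat]
  exact (matPCBBound_fin_one p _ _).1 (mat_bound (Matrix.of fun _ _ : Fin 1 => u))

theorem norm_le_of_bound (u : CB p X Y) {C : ℝ} (hC : 0 ≤ C) (h : PCBBound p (toLin u) C) :
    ‖u‖ ≤ C := csInf_le ⟨0, fun _ h => h.1⟩ ⟨hC, h⟩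

theorem norm_apply_le (u : CB p X Y) (x : X) : ‖u x‖ ≤ ‖u‖ * ‖x‖ := by
  have h := pcbBound_norm u 1 (Matrix.of fun _ _ => x)
  rwa [POperatorStructure.mnorm_one, POperatorStructure.mnorm_one] at h

theorem mat_add_le {ι : Type*} [Fintype ι] (F G : Matrix ι ι (CB p X Y)) :
    matPCBNorm p ((F + G).map toLin) ≤
      matPCBNorm p (F.map toLin) + matPCBNorm p (G.map toLin) := by
  rw [Matrix.map_add _ (map_add toLin)]
  exact matPCBNorm_le p _ (add_nonneg (matPCBNorm_nonneg p _) (matPCBNorm_nonneg p _))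
    (matPCBBound_add p (mat_bound F) (mat_bound G))

theorem norm_smul_le' (c : ℂ) (u : CB p X Y) : ‖c • u‖ ≤ ‖c‖ * ‖u‖ := by
  refine norm_le_of_bound _ (mul_nonneg (norm_nonneg _) (norm_nonneg' u)) fun n A => ?_
  have h : A.map (toLin (c • u)) = c • A.map (toLin u) := by ext; simp
  rw [h, map_smul_eq_mul, mul_assoc]
  exact mul_le_mul_of_nonneg_left (pcbBound_norm u n A) (norm_nonneg _)

theorem normCore : NormedSpace.Core ℂ (CB p X Y) where
  norm_nonneg := norm_nonneg'
  norm_smul c u := by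
    refine le_antisymm (norm_smul_le' c u) ?_
    by_cases hc : c = 0
    · subst hc; simpa using norm_nonneg' _
    · have h := norm_smul_le' c⁻¹ (c • u)
      rw [smul_smul, inv_mul_cancel₀ hc, one_smul, norm_inv] at h
      have hc' : 0 < ‖c‖ := norm_pos_iff.2 hc
      rwa [le_inv_mul_iff₀ hc'] at h
  norm_triangle u v := by
    simp only [norm_eq_mat]
    exact mat_add_le (Matrix.of fun _ _ : Fin 1 => u) (Matrix.of fun _ _ : Fin 1 => v)
  norm_eq_zero_iff u := by
    refine ⟨fun h => toLin_injective ?_, fun h => ?_⟩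
    · ext x
      have hx := norm_apply_le u x
      rw [h, zero_mul] at hx
      simpa using hx
    · subst h
      have h := norm_smul_le' (0 : ℂ) (0 : CB p X Y)
      rw [smul_zero, norm_zero, zero_mul] at h
      exact le_antisymm h (norm_nonneg' _)

noncomputable instance : NormedAddCommGroup (CB p X Y) := NormedAddCommGroup.ofCore normCore
noncomputable instance : NormedSpace ℂ (CB p X Y) := NormedSpace.ofCore normCore

/-- `M_n(CB_p(X, Y))` is normed as `CB_p(X, M_n(Y))`. -/
noncomputable instance instPOperatorStructure : POperatorStructure p (CB p X Y) :=
  POperatorStructure.ofBounds p (fun _ F => matPCBNorm p (F.map toLin))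
    (fun _ _ => matPCBNorm_nonneg p _) (fun _ F G => mat_add_le F G)
    (fun F => by
      rw [norm_eq_mat]
      congr 1
      ext i j
      rw [Subsingleton.elim i 0, Subsingleton.elim j 0]
      rfl)
    (fun F G => by
      rw [Matrix.reindex_apply, ← Matrix.submatrix_map,
        Matrix.fromBlocks_map, Matrix.map_zero _ (map_zero _), Matrix.map_zero _ (map_zero _)]
      refine matPCBNorm_le p _ (le_max_of_le_left (matPCBNorm_nonneg p _))
        (matPCBBound_directSum p (fun k A => (mat_bound F k A).trans ?_)
          fun k A => (mat_bound G k A).trans ?_)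
      · exact mul_le_mul_of_nonneg_right (le_max_left _ _) (apply_nonneg _ _)
      · exact mul_le_mul_of_nonneg_right (le_max_right _ _) (apply_nonneg _ _))
    (fun α F β => by
      rw [compress_map]
      exact matPCBNorm_le p _ (mul_nonneg (mul_nonneg (lpOpNorm_nonneg p _)
        (matPCBNorm_nonneg p _)) (lpOpNorm_nonneg p _))
        (matPCBBound_compress p α β (matPCBNorm_nonneg p _) (mat_bound F)))

theorem continuous_apply (x : X) : Continuous fun u : CB p X Y => u x := by
  have := (LinearMap.mkContinuous ((LinearMap.applyₗ x).comp (toLin (p := p) (X := X) (Y := Y)))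
    ‖x‖ fun u => by rw [mul_comm]; exact norm_apply_le u x).continuous
  exact this

instance [CompleteSpace Y] : CompleteSpace (CB p X Y) := by
  refine Metric.complete_of_cauchySeq_tendsto fun u hu => ?_
  have hx : ∀ x, ∃ y, Filter.Tendsto (fun n => u n x) Filter.atTop (nhds y) := fun x => by
    have : CauchySeq fun n => u n x := by
      have hl : LipschitzWith ‖x‖₊ fun v : CB p X Y => v x :=
        LipschitzWith.of_dist_le_mul fun v w => by
          rw [dist_eq_norm, dist_eq_norm, mul_comm]
          have := norm_apply_le (v - w) x
          simpa using this
      exact hu.map hl.uniformContinuous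
    exact cauchySeq_tendsto_of_complete this
  choose f hf using hx
  let L : X →ₗ[ℂ] Y :=
    { toFun := f
      map_add' := fun x y => tendsto_nhds_unique (hf (x + y)) (by
        simpa using (hf x).add (hf y))
      map_smul' := fun c x => tendsto_nhds_unique (hf (c • x)) (by
        simpa using (hf x).const_smul c) }
  have key : ∀ ε > 0, ∃ N, ∀ n ≥ N, PCBBound p (L - toLin (u n)) ε := fun ε hε => by
    obtain ⟨N, hN⟩ := Metric.cauchySeq_iff.1 hu ε hε
    refine ⟨N, fun n hn k A => ?_⟩
    have ht : Filter.Tendsto (fun m => A.map (toLin (u m - u n))) Filter.atTop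
        (nhds (A.map (L - toLin (u n)))) := by
      refine tendsto_pi_nhds.2 fun i => tendsto_pi_nhds.2 fun j => ?_
      have := (hf (A i j)).sub_const (u n (A i j))
      refine this.congr fun m => ?_
      simp
    refine le_of_tendsto (((continuous_mnorm p k).tendsto _).comp ht)
      (Filter.eventually_atTop.2 ⟨N, fun m hm => ?_⟩)
    refine (pcbBound_norm (u m - u n) k A).trans
      (mul_le_mul_of_nonneg_right ?_ (apply_nonneg _ _))
    rw [← dist_eq_norm]
    exact (hN m hm n hn).le
  have hmem : L ∈ cbSubmodule p X Y := by
    obtain ⟨N, hN⟩ := key 1 one_pos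
    have h1 : L - toLin (u N) ∈ cbSubmodule p X Y := ⟨1, zero_le_one, hN N le_rfl⟩
    have h2 := (cbSubmodule p X Y).add_mem h1 (exists_bound (u N))
    rwa [sub_add_cancel] at h2
  refine ⟨mk L hmem, Metric.tendsto_atTop.2 fun ε hε => ?_⟩
  obtain ⟨N, hN⟩ := key (ε / 2) (half_pos hε)
  refine ⟨N, fun n hn => ?_⟩
  rw [dist_comm, dist_eq_norm]
  refine lt_of_le_of_lt (norm_le_of_bound _ (half_pos hε).le ?_) (half_lt_self hε)
  exact hN n hn

end CB

end CBSpace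

/-- The `p`-operator dual `X' = CB_p(X, ℂ)`. -/
abbrev PDual (p : ℝ) [Fact (1 < p)] (X : Type*) [SeminormedAddCommGroup X] [NormedSpace ℂ X]
    [POperatorStructure p X] : Type _ := CB p X ℂ

section Injective

variable (p : ℝ) [Fact (1 < p)] (V : Type*) [NormedAddCommGroup V] [NormedSpace ℂ V]
  [POperatorStructure p V] (W : Type*) [NormedAddCommGroup W] [NormedSpace ℂ W]
  [POperatorStructure p W]

variable {W} in
theorem mnorm_diagonal_le (n : ℕ) (y : W) :
    POperatorStructure.mnorm p n (Matrix.diagonal fun _ => y) ≤ ‖y‖ := by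
  induction n with
  | zero =>
    have h : (Matrix.diagonal fun _ : Fin 0 => y) = 0 := Subsingleton.elim _ _
    rw [h, map_zero]
    exact norm_nonneg _
  | succ n ih =>
    have h : (Matrix.diagonal fun _ : Fin (n + 1) => y) =
        Matrix.reindex finSumFinEquiv finSumFinEquiv (Matrix.fromBlocks
          (Matrix.diagonal fun _ : Fin n => y) 0 0 (Matrix.diagonal fun _ : Fin 1 => y)) := by
      rw [Matrix.fromBlocks_diagonal, Matrix.reindex_apply, Matrix.submatrix_diagonal_equiv]
      congr 1
      ext i
      rcases finSumFinEquiv.symm i with s | s <;> simp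
    rw [h, POperatorStructure.mnorm_directSum, POperatorStructure.mnorm_one]
    exact max_le ih (by simp)

variable {V W}

theorem mnorm_eval_le {n : ℕ} (A : Matrix (Fin n) (Fin n) (CB p V W)) (x : V) :
    POperatorStructure.mnorm p n (A.map fun f => f x) ≤ POperatorStructure.mnorm p n A * ‖x‖ := by
  have h := CB.mat_bound A 1 (Matrix.of fun _ _ => x)
  rw [POperatorStructure.mnorm_one] at h
  refine le_trans (le_of_eq ?_) h
  rw [← fnorm_fin, ← fnorm_submatrix p _ (Equiv.uniqueProd (Fin n) (Fin 1))]
  rfl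

/-- The operator `f ↦ f(x) y` in `CB_p(V', W)`. -/
noncomputable def rankOne (x : V) (y : W) : CB p (PDual p V) W :=
  CB.mk
    { toFun := fun f => f x • y
      map_add' := fun f g => by simp [add_smul]
      map_smul' := fun c f => by simp [mul_smul] }
    ⟨‖x‖ * ‖y‖, by positivity, fun n A => by
      have h : A.map (fun f => f x • y) =
          compress (A.map fun f => f x) (Matrix.diagonal fun _ => y)
            (1 : Matrix (Fin n) (Fin n) ℂ) := by
        ext i j
        rw [compress_apply, Finset.sum_eq_single j, Finset.sum_eq_single j]
        · simp
        · intro b _ hb; simp [hb]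
        · simp
        · intro b _ hb
          refine Finset.sum_eq_zero fun c _ => ?_
          by_cases hc : c = j
          · subst hc; simp [hb]
          · simp [hc]
        · simp
      change POperatorStructure.mnorm p n (A.map (fun f => f x • y)) ≤ _
      rw [h]
      refine (POperatorStructure.mnorm_compress _ _ _).trans ?_
      have h1 := mnorm_eval_le p A x
      have h2 := mnorm_diagonal_le p n y
      have h3 := lpOpNorm_one_le (ι := Fin n) p
      have h4 := lpOpNorm_nonneg p (1 : Matrix (Fin n) (Fin n) ℂ)
      have h5 : 0 ≤ POperatorStructure.mnorm p n A := apply_nonneg _ _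
      have h6 : 0 ≤ POperatorStructure.mnorm p n (Matrix.diagonal fun _ => y) := apply_nonneg _ _
      change lpOpNorm p (A.map fun f => f x) ≤ _ at h1
      calc _ ≤ (POperatorStructure.mnorm p n A * ‖x‖) * ‖y‖ * 1 := by gcongr
        _ = _ := by ring⟩

theorem rankOne_apply (x : V) (y : W) (f : PDual p V) : rankOne p x y f = f x • y := rfl

variable (V W)

/-- The map `V ⊗ W → CB_p(V', W)`, `x ⊗ y ↦ (f ↦ f(x) y)`. -/
noncomputable def injMap : V ⊗[ℂ] W →ₗ[ℂ] CB p (PDual p V) W :=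
  TensorProduct.lift (LinearMap.mk₂ ℂ (rankOne p)
    (fun x x' y => CB.toLin_injective (by ext f; simp [rankOne_apply, add_smul]))
    (fun c x y => CB.toLin_injective (by ext f; simp [rankOne_apply, mul_smul]))
    (fun x y y' => CB.toLin_injective (by ext f; simp [rankOne_apply]))
    (fun c x y => CB.toLin_injective (by ext f; simp [rankOne_apply, smul_comm c])))

/-- The `p`-operator space injective tensor product: the completion of `V ⊗ W` in `CB_p(V', W)`,
that is, the closure of `V ⊗ W` in that (complete) space, with the inherited matrix norms. -/
noncomputable abbrev InjTensor : Submodule ℂ (CB p (PDual p V) W) :=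
  (LinearMap.range (injMap p V W)).topologicalClosure

variable {V W}

/-- The elementary tensor `x ⊗ y` in the injective tensor product. -/
noncomputable def injTmul (x : V) (y : W) : InjTensor p V W :=
  ⟨injMap p V W (x ⊗ₜ y), Submodule.le_topologicalClosure _ ⟨_, rfl⟩⟩

end Injective

section Projective

variable (p : ℝ) [Fact (1 < p)] (X : Type*) [SeminormedAddCommGroup X] [NormedSpace ℂ X]
  [POperatorStructure p X] (Y : Type*) [SeminormedAddCommGroup Y] [NormedSpace ℂ Y]
  [POperatorStructure p Y]

variable {X Y} in
/-- The tensor product `v ⊗ w = [v_{ij} ⊗ w_{kl}]` of two matrices. -/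
def kron {ρ σ : Type*} (v : Matrix ρ ρ X) (w : Matrix σ σ Y) :
    Matrix (ρ × σ) (ρ × σ) (X ⊗[ℂ] Y) :=
  Matrix.of fun a b => v a.1 b.1 ⊗ₜ w a.2 b.2

variable {X Y}

/-- The numbers `‖α‖ ‖v‖ ‖w‖ ‖β‖` for all representations `u = α (v ⊗ w) β`. -/
def projSet {n : ℕ} (u : Matrix (Fin n) (Fin n) (X ⊗[ℂ] Y)) : Set ℝ :=
  {c | ∃ (r s : ℕ) (α : Matrix (Fin n) (Fin r × Fin s) ℂ) (v : Matrix (Fin r) (Fin r) X)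
    (w : Matrix (Fin s) (Fin s) Y) (β : Matrix (Fin r × Fin s) (Fin n) ℂ),
    u = compress α (kron v w) β ∧
    c = lpOpNorm p α * POperatorStructure.mnorm p r v * POperatorStructure.mnorm p s w *
      lpOpNorm p β}

/-- The projective matrix norm `‖u‖_{∧_p}` on `M_n(X ⊗ Y)`. -/
noncomputable def projNorm {n : ℕ} (u : Matrix (Fin n) (Fin n) (X ⊗[ℂ] Y)) : ℝ :=
  sInf (projSet p u)

/-- `u` has a representation by factors bounded by `a`, `1`, `1`, `b`. -/
def HasRep {n : ℕ} (u : Matrix (Fin n) (Fin n) (X ⊗[ℂ] Y)) (a b : ℝ) : Prop :=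
  ∃ (r s : ℕ) (α : Matrix (Fin n) (Fin r × Fin s) ℂ) (v : Matrix (Fin r) (Fin r) X)
    (w : Matrix (Fin s) (Fin s) Y) (β : Matrix (Fin r × Fin s) (Fin n) ℂ),
    u = compress α (kron v w) β ∧ lpOpNorm p α ≤ a ∧ POperatorStructure.mnorm p r v ≤ 1 ∧
      POperatorStructure.mnorm p s w ≤ 1 ∧ lpOpNorm p β ≤ b

theorem projSet_nonneg {n : ℕ} (u : Matrix (Fin n) (Fin n) (X ⊗[ℂ] Y)) :
    ∀ c ∈ projSet p u, 0 ≤ c := by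
  rintro c ⟨r, s, α, v, w, β, -, rfl⟩
  have h1 := lpOpNorm_nonneg p α
  have h2 := lpOpNorm_nonneg p β
  have h3 : 0 ≤ POperatorStructure.mnorm p r v := apply_nonneg _ _
  have h4 : 0 ≤ POperatorStructure.mnorm p s w := apply_nonneg _ _
  positivity

theorem projNorm_nonneg {n : ℕ} (u : Matrix (Fin n) (Fin n) (X ⊗[ℂ] Y)) : 0 ≤ projNorm p u :=
  Real.sInf_nonneg (projSet_nonneg p u)

theorem projNorm_le_of_hasRep {n : ℕ} {u : Matrix (Fin n) (Fin n) (X ⊗[ℂ] Y)} {a b : ℝ}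
    (h : HasRep p u a b) : projNorm p u ≤ a * b := by
  obtain ⟨r, s, α, v, w, β, hu, hα, hv, hw, hβ⟩ := h
  refine (csInf_le ⟨0, projSet_nonneg p u⟩ ⟨r, s, α, v, w, β, hu, rfl⟩).trans ?_
  have h1 := lpOpNorm_nonneg p α
  have h2 := lpOpNorm_nonneg p β
  have h3 : 0 ≤ POperatorStructure.mnorm p r v := apply_nonneg _ _
  have h4 : 0 ≤ POperatorStructure.mnorm p s w := apply_nonneg _ _
  have h5 : 0 ≤ a := h1.trans hα
  calc _ ≤ a * 1 * 1 * b := by gcongr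
    _ = a * b := by ring

theorem kron_smul {ρ σ : Type*} (c d : ℂ) (v : Matrix ρ ρ X) (w : Matrix σ σ Y) :
    kron (c • v) (d • w) = (c * d) • kron v w := by
  ext i j
  simp [kron, TensorProduct.smul_tmul', TensorProduct.tmul_smul, smul_smul, mul_comm]

theorem hasRep_of_mem {n : ℕ} {u : Matrix (Fin n) (Fin n) (X ⊗[ℂ] Y)} {c a b : ℝ}
    (hc : c ∈ projSet p u) (ha : 0 < a) (hb : 0 < b) (hab : c < a * b) : HasRep p u a b := by
  obtain ⟨r, s, α, v, w, β, hu, rfl⟩ := hc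
  set A := lpOpNorm p α
  set B := lpOpNorm p β
  set V := POperatorStructure.mnorm p r v
  set W := POperatorStructure.mnorm p s w
  have hA : 0 ≤ A := lpOpNorm_nonneg p α
  have hB : 0 ≤ B := lpOpNorm_nonneg p β
  have hV : 0 ≤ V := apply_nonneg _ _
  have hW : 0 ≤ W := apply_nonneg _ _
  obtain ⟨ε, hε, hlt⟩ : ∃ ε > 0, A * (V + ε) * (W + ε) * (B + ε) < a * b := by
    have hcont : Filter.Tendsto (fun ε : ℝ => A * (V + ε) * (W + ε) * (B + ε))
        (nhdsWithin 0 (Set.Ioi 0)) (nhds (A * (V + 0) * (W + 0) * (B + 0))) :=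
      (Continuous.tendsto (by fun_prop) 0).mono_left nhdsWithin_le_nhds
    simp only [add_zero] at hcont
    obtain ⟨ε, h1, h2⟩ := ((hcont.eventually_lt_const hab).and self_mem_nhdsWithin).exists
    exact ⟨ε, h2, h1⟩
  have hV' : 0 < V + ε := by positivity
  have hW' : 0 < W + ε := by positivity
  have hB' : 0 < B + ε := by positivity
  set k : ℝ := b / (B + ε) with hk
  have hk0 : 0 < k := by positivity
  refine ⟨r, s, (((V + ε) * (W + ε) / k : ℝ) : ℂ) • α, (((V + ε)⁻¹ : ℝ) : ℂ) • v,
    (((W + ε)⁻¹ : ℝ) : ℂ) • w, ((k : ℝ) : ℂ) • β, ?_, ?_, ?_, ?_, ?_⟩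
  · rw [hu, kron_smul]
    ext i j
    simp only [compress_apply, Matrix.smul_apply, smul_smul, smul_eq_mul]
    refine Finset.sum_congr rfl fun x _ => Finset.sum_congr rfl fun y _ => ?_
    congr 1
    have e1 : ((V + ε : ℝ) : ℂ) ≠ 0 := by exact_mod_cast hV'.ne'
    have e2 : ((W + ε : ℝ) : ℂ) ≠ 0 := by exact_mod_cast hW'.ne'
    have e3 : ((k : ℝ) : ℂ) ≠ 0 := by exact_mod_cast hk0.ne'
    rw [Complex.ofReal_div, Complex.ofReal_mul, Complex.ofReal_inv, Complex.ofReal_inv]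
    field_simp
  · refine (lpOpNorm_smul_le p _ _).trans ?_
    rw [Complex.norm_real, Real.norm_of_nonneg (by positivity), hk, div_div_eq_mul_div,
      div_mul_eq_mul_div, div_le_iff₀ hb]
    change (V + ε) * (W + ε) * (B + ε) * A ≤ a * b
    nlinarith
  · rw [map_smul_eq_mul, Complex.norm_real, Real.norm_of_nonneg (by positivity),
      inv_mul_le_iff₀ hV']
    change V ≤ _
    linarith
  · rw [map_smul_eq_mul, Complex.norm_real, Real.norm_of_nonneg (by positivity),
      inv_mul_le_iff₀ hW']
    change W ≤ _
    linarith
  · refine (lpOpNorm_smul_le p _ _).trans ?_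
    rw [Complex.norm_real, Real.norm_of_nonneg hk0.le, hk, div_mul_eq_mul_div, div_le_iff₀ hB']
    change b * B ≤ _
    nlinarith

theorem hasRep_of_fintype {n : ℕ} {ρ σ : Type*} [Fintype ρ] [Fintype σ]
    {u : Matrix (Fin n) (Fin n) (X ⊗[ℂ] Y)} {a b : ℝ}
    (α : Matrix (Fin n) (ρ × σ) ℂ) (v : Matrix ρ ρ X) (w : Matrix σ σ Y)
    (β : Matrix (ρ × σ) (Fin n) ℂ) (hu : u = compress α (kron v w) β) (hα : lpOpNorm p α ≤ a)
    (hv : fnorm p v ≤ 1) (hw : fnorm p w ≤ 1) (hβ : lpOpNorm p β ≤ b) : HasRep p u a b := by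
  let e := Equiv.prodCongr (Fintype.equivFin ρ).symm (Fintype.equivFin σ).symm
  refine ⟨Fintype.card ρ, Fintype.card σ, α.submatrix (Equiv.refl _) e,
    Matrix.reindex (Fintype.equivFin ρ) (Fintype.equivFin ρ) v,
    Matrix.reindex (Fintype.equivFin σ) (Fintype.equivFin σ) w,
    β.submatrix e (Equiv.refl _), ?_, ?_, hv, hw, ?_⟩
  · have h : kron (Matrix.reindex (Fintype.equivFin ρ) (Fintype.equivFin ρ) v)
        (Matrix.reindex (Fintype.equivFin σ) (Fintype.equivFin σ) w) =
        (kron v w).submatrix e e := rfl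
    rw [h, compress_submatrix, hu]
    rfl
  · rwa [lpOpNorm_submatrix]
  · rwa [lpOpNorm_submatrix]

/-- The inclusion of the two diagonal blocks. -/
def blockIncl (ρ σ ρ' σ' : Type*) : (ρ × σ) ⊕ (ρ' × σ') → (ρ ⊕ ρ') × (σ ⊕ σ') :=
  Sum.elim (fun x => (Sum.inl x.1, Sum.inl x.2)) (fun x => (Sum.inr x.1, Sum.inr x.2))

theorem blockIncl_injective (ρ σ ρ' σ' : Type*) :
    Function.Injective (blockIncl ρ σ ρ' σ') := by
  rintro (⟨a, b⟩ | ⟨a, b⟩) (⟨c, d⟩ | ⟨c, d⟩) h <;>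
    simp_all [blockIncl]

theorem hasRep_blocks {n : ℕ} {ρ σ ρ' σ' : Type*} [Fintype ρ] [Fintype σ] [Fintype ρ']
    [Fintype σ'] {u : Matrix (Fin n) (Fin n) (X ⊗[ℂ] Y)} {a b : ℝ}
    (α : Matrix (Fin n) ((ρ × σ) ⊕ (ρ' × σ')) ℂ) (v : Matrix ρ ρ X) (w : Matrix σ σ Y)
    (v' : Matrix ρ' ρ' X) (w' : Matrix σ' σ' Y) (β : Matrix ((ρ × σ) ⊕ (ρ' × σ')) (Fin n) ℂ)
    (hu : u = compress α (Matrix.fromBlocks (kron v w) 0 0 (kron v' w')) β)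
    (hα : lpOpNorm p α ≤ a) (hv : fnorm p v ≤ 1) (hw : fnorm p w ≤ 1) (hv' : fnorm p v' ≤ 1)
    (hw' : fnorm p w' ≤ 1) (hβ : lpOpNorm p β ≤ b) : HasRep p u a b := by
  classical
  have hk : Matrix.fromBlocks (kron v w) 0 0 (kron v' w') =
      (kron (Matrix.fromBlocks v 0 0 v') (Matrix.fromBlocks w 0 0 w')).submatrix
        (blockIncl ρ σ ρ' σ') (blockIncl ρ σ ρ' σ') := by
    ext (i | i) (j | j) <;> simp [kron, blockIncl]
  rw [hk, ← compress_one_submatrix, compress_compress] at hu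
  have h1 := lpOpNorm_row_le p (blockIncl_injective ρ σ ρ' σ')
  have h2 := lpOpNorm_col_le p (blockIncl_injective ρ σ ρ' σ')
  refine hasRep_of_fintype p _ _ _ _ hu ?_ (mnorm_directSum_le_of_le p _ _ hv hv')
    (mnorm_directSum_le_of_le p _ _ hw hw') ?_
  · exact (lpOpNorm_mul_le p _ _).trans
      ((mul_le_of_le_one_right (lpOpNorm_nonneg p _) h1).trans hα)
  · exact (lpOpNorm_mul_le p _ _).trans
      ((mul_le_of_le_one_left (lpOpNorm_nonneg p _) h2).trans hβ)

theorem hasRep_add {n : ℕ} {u u' : Matrix (Fin n) (Fin n) (X ⊗[ℂ] Y)} {c d : ℝ} (hc : 0 ≤ c)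
    (hd : 0 ≤ d) (hu : HasRep p u (c ^ (1 - 1 / p)) (c ^ (1 / p)))
    (hu' : HasRep p u' (d ^ (1 - 1 / p)) (d ^ (1 / p))) :
    HasRep p (u + u') ((c + d) ^ (1 - 1 / p)) ((c + d) ^ (1 / p)) := by
  obtain ⟨r, s, α, v, w, β, rfl, hα, hv, hw, hβ⟩ := hu
  obtain ⟨r', s', α', v', w', β', rfl, hα', hv', hw', hβ'⟩ := hu'
  rw [← fnorm_fin] at hv hw hv' hw'
  exact hasRep_blocks p (Matrix.fromCols α α') v w v' w' (Matrix.fromRows β β')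
    (compress_fromCols_fromRows _ _ _ _ _ _).symm (lpOpNorm_fromCols_le p _ _ hc hd hα hα')
    hv hw hv' hw' (lpOpNorm_fromRows_le p _ _ hc hd hβ hβ')

theorem hasRep_directSum {n m : ℕ} {u : Matrix (Fin n) (Fin n) (X ⊗[ℂ] Y)}
    {u' : Matrix (Fin m) (Fin m) (X ⊗[ℂ] Y)} {a b : ℝ} (hu : HasRep p u a b)
    (hu' : HasRep p u' a b) : HasRep p
      (Matrix.reindex finSumFinEquiv finSumFinEquiv (Matrix.fromBlocks u 0 0 u')) a b := by
  obtain ⟨r, s, α, v, w, β, rfl, hα, hv, hw, hβ⟩ := hu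
  obtain ⟨r', s', α', v', w', β', rfl, hα', hv', hw', hβ'⟩ := hu'
  rw [← fnorm_fin] at hv hw hv' hw'
  refine hasRep_blocks p
    ((Matrix.fromBlocks α 0 0 α').submatrix finSumFinEquiv.symm (Equiv.refl _)) v w v' w'
    ((Matrix.fromBlocks β 0 0 β').submatrix (Equiv.refl _) finSumFinEquiv.symm) ?_ ?_
    hv hw hv' hw' ?_
  · rw [← compress_fromBlocks, Matrix.reindex_apply, ← compress_submatrix _ _ _ _ (Equiv.refl _)]
    rfl
  · rw [lpOpNorm_submatrix]
    exact (lpOpNorm_fromBlocks_le p _ _).trans (max_le hα hα')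
  · rw [lpOpNorm_submatrix]
    exact (lpOpNorm_fromBlocks_le p _ _).trans (max_le hβ hβ')

theorem rpow_split {c : ℝ} (hc : 0 < c) : c ^ (1 - 1 / p) * c ^ (1 / p) = c := by
  rw [← Real.rpow_add hc, sub_add_cancel, Real.rpow_one]

theorem projSet_nonempty {n : ℕ} (u : Matrix (Fin n) (Fin n) (X ⊗[ℂ] Y)) :
    (projSet p u).Nonempty := by
  classical
  have of_rep : ∀ {u : Matrix (Fin n) (Fin n) (X ⊗[ℂ] Y)} {a b : ℝ}, HasRep p u a b →
      (projSet p u).Nonempty := fun h => by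
    obtain ⟨r, s, α, v, w, β, hu, -⟩ := h
    exact ⟨_, r, s, α, v, w, β, hu, rfl⟩
  have hadd : ∀ {u u' : Matrix (Fin n) (Fin n) (X ⊗[ℂ] Y)}, (projSet p u).Nonempty →
      (projSet p u').Nonempty → (projSet p (u + u')).Nonempty := fun {u u'} h h' => by
    obtain ⟨c, hc⟩ := h
    obtain ⟨d, hd⟩ := h'
    have hc0 := projSet_nonneg p u c hc
    have hd0 := projSet_nonneg p u' d hd
    have hc1 : 0 < c + 1 := by linarith
    have hd1 : 0 < d + 1 := by linarith
    refine of_rep (hasRep_add p hc1.le hd1.le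
      (hasRep_of_mem p hc (by positivity) (by positivity) ?_)
      (hasRep_of_mem p hd (by positivity) (by positivity) ?_))
    · rw [rpow_split p hc1]; linarith
    · rw [rpow_split p hd1]; linarith
  have hzero : (projSet p (0 : Matrix (Fin n) (Fin n) (X ⊗[ℂ] Y))).Nonempty :=
    ⟨_, 0, 0, 0, 0, 0, 0, (compress_zero_left _ _).symm, rfl⟩
  have hsum : ∀ {τ : Type} (t : Finset τ) (f : τ → Matrix (Fin n) (Fin n) (X ⊗[ℂ] Y)),
      (∀ i, (projSet p (f i)).Nonempty) → (projSet p (∑ i ∈ t, f i)).Nonempty := by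
    intro τ t f hf
    induction t using Finset.induction_on with
    | empty => simpa using hzero
    | insert a t ha ih => rw [Finset.sum_insert ha]; exact hadd (hf a) ih
  rw [Matrix.matrix_eq_sum_single u]
  refine hsum _ _ fun i => hsum _ _ fun j => ?_
  induction u i j using TensorProduct.induction_on with
  | zero => simpa using hzero
  | add x y hx hy => rw [Matrix.single_add]; exact hadd hx hy
  | tmul x y =>
    refine ⟨_, 1, 1, (1 : Matrix (Fin n) (Fin n) ℂ).submatrix id fun _ => i,
      Matrix.of fun _ _ => x, Matrix.of fun _ _ => y,
      (1 : Matrix (Fin n) (Fin n) ℂ).submatrix (fun _ => j) id, ?_, rfl⟩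
    ext k l
    simp [compress_apply, kron, Matrix.single_apply, Matrix.one_apply, ← ite_and, eq_comm,
      and_comm]

theorem hasRep_of_lt {n : ℕ} {u : Matrix (Fin n) (Fin n) (X ⊗[ℂ] Y)} {a b : ℝ} (ha : 0 < a)
    (hb : 0 < b) (h : projNorm p u < a * b) : HasRep p u a b := by
  obtain ⟨c, hc, hlt⟩ := exists_lt_of_csInf_lt (projSet_nonempty p u) h
  exact hasRep_of_mem p hc ha hb hlt

theorem projNorm_add_le {n : ℕ} (u u' : Matrix (Fin n) (Fin n) (X ⊗[ℂ] Y)) :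
    projNorm p (u + u') ≤ projNorm p u + projNorm p u' := by
  refine le_of_forall_pos_le_add fun ε hε => ?_
  have hc : 0 < projNorm p u + ε / 2 := by have := projNorm_nonneg p u; positivity
  have hd : 0 < projNorm p u' + ε / 2 := by have := projNorm_nonneg p u'; positivity
  have h := projNorm_le_of_hasRep p (hasRep_add p hc.le hd.le
    (hasRep_of_lt p (u := u) (by positivity) (by positivity) (by rw [rpow_split p hc]; linarith))
    (hasRep_of_lt p (u := u') (by positivity) (by positivity) (by rw [rpow_split p hd]; linarith)))
  rw [rpow_split p (add_pos hc hd)] at h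
  linarith

theorem projNorm_directSum_le {n m : ℕ} (u : Matrix (Fin n) (Fin n) (X ⊗[ℂ] Y))
    (u' : Matrix (Fin m) (Fin m) (X ⊗[ℂ] Y)) : projNorm p
      (Matrix.reindex finSumFinEquiv finSumFinEquiv (Matrix.fromBlocks u 0 0 u')) ≤
      max (projNorm p u) (projNorm p u') := by
  refine le_of_forall_pos_le_add fun ε hε => ?_
  have hc : 0 < max (projNorm p u) (projNorm p u') + ε := by
    have := le_max_of_le_left (b := projNorm p u) (c := projNorm p u') (projNorm_nonneg p u)
    positivity
  have h1 := le_max_left (projNorm p u) (projNorm p u')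
  have h2 := le_max_right (projNorm p u) (projNorm p u')
  have h := projNorm_le_of_hasRep p (hasRep_directSum p
    (hasRep_of_lt p (u := u) hc one_pos (by linarith))
    (hasRep_of_lt p (u := u') hc one_pos (by linarith)))
  rwa [mul_one] at h

theorem projNorm_compress_le {n m : ℕ} (γ : Matrix (Fin n) (Fin m) ℂ)
    (u : Matrix (Fin m) (Fin m) (X ⊗[ℂ] Y)) (δ : Matrix (Fin m) (Fin n) ℂ) :
    projNorm p (compress γ u δ) ≤ lpOpNorm p γ * projNorm p u * lpOpNorm p δ := by
  rw [mul_right_comm]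
  refine le_mul_csInf (projSet_nonempty p u)
    (mul_nonneg (lpOpNorm_nonneg p _) (lpOpNorm_nonneg p _)) ?_
  rintro c ⟨r, s, α, v, w, β, rfl, rfl⟩
  rw [compress_compress]
  refine (csInf_le ⟨0, projSet_nonneg p _⟩ ⟨r, s, γ * α, v, w, β * δ, rfl, rfl⟩).trans ?_
  have h1 := lpOpNorm_nonneg p γ
  have h2 := lpOpNorm_nonneg p α
  have h3 : 0 ≤ POperatorStructure.mnorm p r v := apply_nonneg _ _
  have h4 : 0 ≤ POperatorStructure.mnorm p s w := apply_nonneg _ _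
  have h5 := lpOpNorm_nonneg p (β * δ)
  calc _ ≤ (lpOpNorm p γ * lpOpNorm p α) * POperatorStructure.mnorm p r v *
        POperatorStructure.mnorm p s w * (lpOpNorm p β * lpOpNorm p δ) := by
        gcongr
        · exact lpOpNorm_mul_le p _ _
        · exact lpOpNorm_mul_le p _ _
    _ = _ := by ring

variable (X Y)

/-- The algebraic tensor product `X ⊗ Y`, to be equipped with the norms `‖·‖_{∧_p}`. -/
def ProjAlg (_p : ℝ) (X : Type*) [SeminormedAddCommGroup X] [NormedSpace ℂ X] (Y : Type*)
    [SeminormedAddCommGroup Y] [NormedSpace ℂ Y] : Type _ := X ⊗[ℂ] Y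

noncomputable instance : AddCommGroup (ProjAlg p X Y) := inferInstanceAs (AddCommGroup (X ⊗[ℂ] Y))
noncomputable instance : Module ℂ (ProjAlg p X Y) := inferInstanceAs (Module ℂ (X ⊗[ℂ] Y))

/-- The norm `‖·‖_{∧_p}` at the first matrix level. -/
noncomputable instance : Norm (ProjAlg p X Y) :=
  ⟨fun z => projNorm p (X := X) (Y := Y) (Matrix.of fun _ _ : Fin 1 => z)⟩

theorem projCore : SeminormedSpace.Core ℂ (ProjAlg p X Y) where
  norm_nonneg z := projNorm_nonneg p _
  norm_smul c z := by
    have key : ∀ (c : ℂ) (z : ProjAlg p X Y), ‖c • z‖ ≤ ‖c‖ * ‖z‖ := fun c z => by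
      have h := projNorm_compress_le p (X := X) (Y := Y) (c • (1 : Matrix (Fin 1) (Fin 1) ℂ))
        (Matrix.of fun _ _ : Fin 1 => z) 1
      rw [compress_smul_one, lpOpNorm_one_by_one, lpOpNorm_one_by_one] at h
      simp only [Matrix.smul_apply, Matrix.one_apply_eq, smul_eq_mul, mul_one, norm_one] at h
      exact h
    refine le_antisymm (key c z) ?_
    by_cases hc : c = 0
    · rw [hc, norm_zero, zero_mul]
      exact projNorm_nonneg p _
    · have h := key c⁻¹ (c • z)
      rw [smul_smul, inv_mul_cancel₀ hc, one_smul, norm_inv] at h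
      have hc' : 0 < ‖c‖ := norm_pos_iff.2 hc
      rwa [le_inv_mul_iff₀ hc'] at h
  norm_triangle z z' := projNorm_add_le p (X := X) (Y := Y) (Matrix.of fun _ _ : Fin 1 => z)
    (Matrix.of fun _ _ : Fin 1 => z')

noncomputable instance : SeminormedAddCommGroup (ProjAlg p X Y) :=
  SeminormedAddCommGroup.ofCore (projCore p X Y)
noncomputable instance : NormedSpace ℂ (ProjAlg p X Y) where
  norm_smul_le c z := ((projCore p X Y).norm_smul c z).le

noncomputable instance instProjAlg : POperatorStructure p (ProjAlg p X Y) :=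
  POperatorStructure.ofBounds p (fun _ u => projNorm p (X := X) (Y := Y) u)
    (fun _ u => projNorm_nonneg p (X := X) (Y := Y) u)
    (fun _ u v => projNorm_add_le p (X := X) (Y := Y) u v)
    (fun u => by
      change _ = projNorm p (X := X) (Y := Y) (Matrix.of fun _ _ : Fin 1 => u 0 0)
      congr 1
      ext i j
      rw [Subsingleton.elim i 0, Subsingleton.elim j 0]
      rfl)
    (fun u v => projNorm_directSum_le p (X := X) (Y := Y) u v)
    (fun α u β => projNorm_compress_le p (X := X) (Y := Y) α u β)

end Projective

section Completion

variable (p : ℝ) [Fact (1 < p)] {X : Type*} [SeminormedAddCommGroup X] [NormedSpace ℂ X]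
  [POperatorStructure p X]

theorem isDenseInducing_matrixCoe (X : Type*) [SeminormedAddCommGroup X] (n : ℕ) :
    IsDenseInducing fun A : Matrix (Fin n) (Fin n) X =>
      A.map ((↑) : X → UniformSpace.Completion X) := by
  have hi : Topology.IsInducing ((↑) : X → UniformSpace.Completion X) :=
    (UniformSpace.Completion.isUniformInducing_coe X).isInducing
  have hd : DenseRange ((↑) : X → UniformSpace.Completion X) :=
    UniformSpace.Completion.denseRange_coe
  exact ⟨Topology.IsInducing.piMap fun _ => Topology.IsInducing.piMap fun _ => hi,
    DenseRange.piMap fun _ => DenseRange.piMap fun _ => hd⟩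

/-- The matrix norms of the completion: the continuous extensions of the given ones. -/
noncomputable def complNorm (n : ℕ) :
    Matrix (Fin n) (Fin n) (UniformSpace.Completion X) → ℝ :=
  (isDenseInducing_matrixCoe X n).extend fun A => POperatorStructure.mnorm p n A

theorem complNorm_coe {n : ℕ} (A : Matrix (Fin n) (Fin n) X) :
    complNorm p n (A.map ((↑) : X → UniformSpace.Completion X)) =
      POperatorStructure.mnorm p n A :=
  (isDenseInducing_matrixCoe X n).extend_eq (continuous_mnorm p n) A

theorem continuous_complNorm (n : ℕ) : Continuous (complNorm p (X := X) n) := by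
  have hu : IsUniformInducing fun A : Matrix (Fin n) (Fin n) X =>
      A.map ((↑) : X → UniformSpace.Completion X) := by
    constructor
    rw [Matrix.uniformity, Matrix.uniformity]
    simp_rw [Filter.comap_iInf, Filter.comap_comap,
      ← (UniformSpace.Completion.isUniformInducing_coe X).comap_uniformity, Filter.comap_comap]
    rfl
  have hf : UniformContinuous fun A : Matrix (Fin n) (Fin n) X =>
      POperatorStructure.mnorm p n A :=
    Seminorm.uniformContinuous_of_continuousAt_zero (continuous_mnorm p n).continuousAt
  exact (uniformContinuous_uniformly_extend hu (isDenseInducing_matrixCoe X n).dense hf).continuous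

theorem compl_induction {n : ℕ} {P : Matrix (Fin n) (Fin n) (UniformSpace.Completion X) → Prop}
    (hP : IsClosed {A | P A})
    (h : ∀ A : Matrix (Fin n) (Fin n) X, P (A.map ((↑) : X → UniformSpace.Completion X)))
    (A) : P A :=
  (isDenseInducing_matrixCoe X n).dense.induction_on A hP h

theorem complNorm_nonneg {n : ℕ} (u : Matrix (Fin n) (Fin n) (UniformSpace.Completion X)) :
    0 ≤ complNorm p n u := by
  refine compl_induction (P := fun u => 0 ≤ complNorm p n u)
    (isClosed_le continuous_const (continuous_complNorm p n)) (fun A => ?_) u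
  rw [complNorm_coe]
  exact apply_nonneg _ _

theorem complNorm_one (u : Matrix (Fin 1) (Fin 1) (UniformSpace.Completion X)) :
    complNorm p 1 u = ‖u 0 0‖ := by
  have h0 : Continuous fun u : Matrix (Fin 1) (Fin 1) (UniformSpace.Completion X) => u 0 0 :=
    continuous_id.matrix_elem 0 0
  refine compl_induction (P := fun u => complNorm p 1 u = ‖u 0 0‖)
    (isClosed_eq (continuous_complNorm p 1) h0.norm) (fun A => ?_) u
  rw [complNorm_coe, POperatorStructure.mnorm_one]
  exact (UniformSpace.Completion.norm_coe _).symm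

theorem complNorm_add_le {n : ℕ} (u v : Matrix (Fin n) (Fin n) (UniformSpace.Completion X)) :
    complNorm p n (u + v) ≤ complNorm p n u + complNorm p n v := by
  have hc := continuous_complNorm p (X := X) n
  have key : ∀ (A : Matrix (Fin n) (Fin n) X) v,
      complNorm p n (A.map ((↑) : X → UniformSpace.Completion X) + v) ≤
        complNorm p n (A.map ((↑) : X → UniformSpace.Completion X)) + complNorm p n v := by
    intro A v
    refine compl_induction
      (P := fun v => complNorm p n (A.map ((↑) : X → UniformSpace.Completion X) + v) ≤
        complNorm p n (A.map ((↑) : X → UniformSpace.Completion X)) + complNorm p n v)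
      (isClosed_le (hc.comp (continuous_const_add _)) (continuous_const.add hc))
      (fun B => ?_) v
    have h : A.map ((↑) : X → UniformSpace.Completion X) +
        B.map ((↑) : X → UniformSpace.Completion X) =
        (A + B).map ((↑) : X → UniformSpace.Completion X) := by
      ext i j
      exact (UniformSpace.Completion.coe_add _ _).symm
    rw [h, complNorm_coe, complNorm_coe, complNorm_coe]
    exact map_add_le_add _ _ _
  exact compl_induction
    (P := fun u => complNorm p n (u + v) ≤ complNorm p n u + complNorm p n v)
    (isClosed_le (hc.comp (continuous_add_const _)) (hc.add continuous_const))
    (fun A => key A v) u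

theorem complNorm_directSum_le {n m : ℕ}
    (u : Matrix (Fin n) (Fin n) (UniformSpace.Completion X))
    (v : Matrix (Fin m) (Fin m) (UniformSpace.Completion X)) :
    complNorm p (n + m) (Matrix.reindex finSumFinEquiv finSumFinEquiv
      (Matrix.fromBlocks u 0 0 v)) ≤ max (complNorm p n u) (complNorm p m v) := by
  have hc := continuous_complNorm p (X := X) n
  have hc' := continuous_complNorm p (X := X) m
  have hc'' := continuous_complNorm p (X := X) (n + m)
  have hb : Continuous fun w : Matrix (Fin n) (Fin n) (UniformSpace.Completion X) ×
      Matrix (Fin m) (Fin m) (UniformSpace.Completion X) =>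
      Matrix.reindex finSumFinEquiv finSumFinEquiv (Matrix.fromBlocks w.1 0 0 w.2) :=
    (Continuous.matrix_fromBlocks continuous_fst continuous_const continuous_const
      continuous_snd).matrix_reindex _ _
  have key : ∀ (A : Matrix (Fin n) (Fin n) X) v,
      complNorm p (n + m) (Matrix.reindex finSumFinEquiv finSumFinEquiv
        (Matrix.fromBlocks (A.map ((↑) : X → UniformSpace.Completion X)) 0 0 v)) ≤
        max (complNorm p n (A.map ((↑) : X → UniformSpace.Completion X)))
          (complNorm p m v) := by
    intro A v
    refine compl_induction
      (P := fun v => complNorm p (n + m) (Matrix.reindex finSumFinEquiv finSumFinEquiv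
        (Matrix.fromBlocks (A.map ((↑) : X → UniformSpace.Completion X)) 0 0 v)) ≤
        max (complNorm p n (A.map ((↑) : X → UniformSpace.Completion X))) (complNorm p m v))
      (isClosed_le (hc''.comp (hb.comp (Continuous.prodMk_right _)))
        (continuous_const.max hc')) (fun B => ?_) v
    have h : Matrix.reindex finSumFinEquiv finSumFinEquiv (Matrix.fromBlocks
        (A.map ((↑) : X → UniformSpace.Completion X)) 0 0
          (B.map ((↑) : X → UniformSpace.Completion X))) =
        (Matrix.reindex finSumFinEquiv finSumFinEquiv (Matrix.fromBlocks A 0 0 B)).map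
          ((↑) : X → UniformSpace.Completion X) := by
      rw [Matrix.reindex_apply, Matrix.reindex_apply, ← Matrix.submatrix_map,
        Matrix.fromBlocks_map, Matrix.map_zero _ UniformSpace.Completion.coe_zero,
        Matrix.map_zero _ UniformSpace.Completion.coe_zero]
    rw [h, complNorm_coe, complNorm_coe, complNorm_coe, POperatorStructure.mnorm_directSum]
  exact compl_induction
    (P := fun u => complNorm p (n + m) (Matrix.reindex finSumFinEquiv finSumFinEquiv
      (Matrix.fromBlocks u 0 0 v)) ≤ max (complNorm p n u) (complNorm p m v))
    (isClosed_le (hc''.comp (hb.comp (Continuous.prodMk_left _))) (hc.max continuous_const))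
    (fun A => key A v) u

theorem complNorm_compress_le {n m : ℕ} (α : Matrix (Fin n) (Fin m) ℂ)
    (u : Matrix (Fin m) (Fin m) (UniformSpace.Completion X)) (β : Matrix (Fin m) (Fin n) ℂ) :
    complNorm p n (compress α u β) ≤ lpOpNorm p α * complNorm p m u * lpOpNorm p β := by
  have hc := continuous_complNorm p (X := X) n
  have hc' := continuous_complNorm p (X := X) m
  have hcomp : Continuous fun u : Matrix (Fin m) (Fin m) (UniformSpace.Completion X) =>
      compress α u β := by
    refine continuous_matrix fun i j => ?_
    change Continuous fun u : Matrix (Fin m) (Fin m) (UniformSpace.Completion X) =>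
      ∑ k, ∑ l, (α i k * β l j) • u k l
    refine continuous_finsetSum _ fun k _ => continuous_finsetSum _ fun l _ => ?_
    exact (continuous_id.matrix_elem k l).const_smul (α i k * β l j)
  refine compl_induction
    (P := fun u => complNorm p n (compress α u β) ≤
      lpOpNorm p α * complNorm p m u * lpOpNorm p β)
    (isClosed_le (hc.comp hcomp) ((continuous_const.mul hc').mul continuous_const))
    (fun A => ?_) u
  have h : compress α (A.map ((↑) : X → UniformSpace.Completion X)) β =
      (compress α A β).map ((↑) : X → UniformSpace.Completion X) :=
    (compress_map (UniformSpace.Completion.toComplL (𝕜 := ℂ) (E := X)).toLinearMap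
      α A β).symm
  rw [h, complNorm_coe, complNorm_coe]
  exact POperatorStructure.mnorm_compress _ _ _

/-- The completion of a space with a `p`-operator space structure. -/
noncomputable instance instCompletion : POperatorStructure p (UniformSpace.Completion X) :=
  POperatorStructure.ofBounds p (complNorm p) (fun _ u => complNorm_nonneg p u)
    (fun _ u v => complNorm_add_le p u v) (complNorm_one p)
    (fun u v => complNorm_directSum_le p u v) (fun α u β => complNorm_compress_le p α u β)

end Completion

section Final

variable (p : ℝ) [Fact (1 < p)] (X : Type*) [SeminormedAddCommGroup X] [NormedSpace ℂ X]
  [POperatorStructure p X] (Y : Type*) [SeminormedAddCommGroup Y] [NormedSpace ℂ Y]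
  [POperatorStructure p Y]

/-- The `p`-operator space projective tensor product: the completion of `X ⊗ Y` with respect to
the norm `‖·‖_{∧_p}`, with the extended matrix norms. -/
abbrev ProjTensor : Type _ := UniformSpace.Completion (ProjAlg p X Y)

variable {X Y}

/-- The elementary tensor `x ⊗ y` in the projective tensor product. -/
noncomputable def projTmul (x : X) (y : Y) : ProjTensor p X Y :=
  UniformSpace.Completion.coe' (α := ProjAlg p X Y) (x ⊗ₜ[ℂ] y : X ⊗[ℂ] Y)

/-- A bilinear map `ψ : X × Y → Z` is jointly `p`-completely contractive if all the maps
`ψ_{r;s} : M_r(X) × M_s(Y) → M_{r × s}(Z)`, `(v, w) ↦ [ψ(v_{ij}, w_{kl})]`, have norm at most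
one. -/
def IsJointlyPCompletelyContractive {Z : Type*} [SeminormedAddCommGroup Z] [NormedSpace ℂ Z]
    [POperatorStructure p Z] (ψ : X →ₗ[ℂ] Y →ₗ[ℂ] Z) : Prop :=
  ∀ (r s : ℕ) (v : Matrix (Fin r) (Fin r) X) (w : Matrix (Fin s) (Fin s) Y),
    fnorm p (Matrix.of fun a b : Fin r × Fin s => ψ (v a.1 b.1) (w a.2 b.2)) ≤
      POperatorStructure.mnorm p r v * POperatorStructure.mnorm p s w

end Final

end POperator

/-! The injective tensor product is a space of operators `T : V' → W`, so `f ∈ V'` and `g ∈ W'` give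
a functional on it by evaluation, `T ↦ g (T f)`. On `T = x ⊗ y`, which sends `f` to `f(x) y`, its
value is `f(x) g(y)`, as required. The construction uses nothing about tensors: for every subspace
`S` of `CB_p(X, Y)` the formula `T ↦ g (T x)` defines a bilinear map `pairing S` from `X × Y'` to
`S'`, and the case `X = V'`, `Y = W`, `S = InjTensor p V W` is the one needed.

Joint `p`-complete contractivity follows from two evaluations (`matPCBBound_pairingLin`). Let `A`,
`v`, `w` be matrices over `S`, `X`, `Y'`. Since `M_k(CB_p(X, Y))` is normed as `CB_p(X, M_k(Y))`,
applying `A` to `v` gives a matrix over `Y` of norm at most `‖A‖ ‖v‖`. Since `M_s(Y')` is normed as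
`CB_p(Y, M_s(ℂ))`, applying `w` to the result gives a scalar matrix of norm at most `‖w‖ ‖A‖ ‖v‖`.
Up to a permutation of the index set this is the matrix `[w_{jl}(A_{ab} v_{ij})]` whose norm has to
be bounded.

Uniqueness of the bilinear map is density: a `p`-completely bounded functional is continuous, and
the algebraic tensors are dense in their closure (`injTensor_dual_ext`, `eq_pairing`).

For the projective tensor product, the linear map on `X ⊗ Y` induced by a jointly `p`-completely
contractive `ψ` sends `α (v ⊗ w) β` to `α [ψ(v_{ij}, w_{kl})] β`, of norm at most `‖α‖ ‖v‖ ‖w‖ ‖β‖`.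
The infimum over representations shows that it is `p`-completely contractive
(`isPCompletelyContractive_projAlgLift`). It extends to the completion because the dual is complete,
and the matrix estimates pass to the extension by continuity. -/

namespace POperator

/-! ### Norms in `M_ι(CB_p(X, Y))` for arbitrary finite index sets. -/

section MatrixBounds

variable {p : ℝ} [Fact (1 < p)] {X : Type*} [SeminormedAddCommGroup X] [NormedSpace ℂ X]
  [POperatorStructure p X] {Y : Type*} [NormedAddCommGroup Y] [NormedSpace ℂ Y]
  [POperatorStructure p Y] {ι κ : Type*} [Fintype ι] [Fintype κ]

/-- The norm of `CB_p(X, M_ι(Y))` bounds the amplifications at matrices over any finite index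
type. -/
theorem CB.fnorm_amplify_le (F : Matrix ι ι (CB p X Y)) (A : Matrix κ κ X) :
    fnorm p (amplify (F.map CB.toLin) A) ≤ fnorm p F * fnorm p A := by
  have h := CB.mat_bound (F.submatrix (Fintype.equivFin ι).symm (Fintype.equivFin ι).symm)
    (Fintype.card κ) (A.submatrix (Fintype.equivFin κ).symm (Fintype.equivFin κ).symm)
  -- Both norms on the right of the goal are by definition those of the enumerated matrices, so only
  -- the left side has to be reindexed.
  refine le_trans (le_of_eq ?_) h
  rw [← fnorm_submatrix p _
    (Equiv.prodCongr (Fintype.equivFin κ).symm (Fintype.equivFin ι).symm)]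
  rfl

/-- The norm is the least nonnegative bound of the amplifications. Stated over any finite `ι` so
that it applies to the index set `Fin r × Fin s` of joint complete contractivity; enumerating `ι`
only permutes the index set of each amplification. -/
theorem CB.fnorm_le_of_matPCBBound (F : Matrix ι ι (CB p X Y)) {C : ℝ} (hC : 0 ≤ C)
    (h : MatPCBBound p (F.map CB.toLin) C) : fnorm p F ≤ C := by
  refine matPCBNorm_le p _ hC fun k A => le_trans (le_of_eq ?_) (h k A)
  rw [← fnorm_submatrix p (amplify (F.map CB.toLin) A)
    (Equiv.prodCongr (Equiv.refl _) (Fintype.equivFin ι).symm)]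
  rfl

end MatrixBounds

/-! ### The evaluation pairing of `X` and `Y'` with values in the dual of a space of operators. -/

section Pairing

variable {p : ℝ} [Fact (1 < p)] {X : Type*} [SeminormedAddCommGroup X] [NormedSpace ℂ X]
  [POperatorStructure p X] {Y : Type*} [NormedAddCommGroup Y] [NormedSpace ℂ Y]
  [POperatorStructure p Y] (S : Submodule ℂ (CB p X Y))

/-- The functional `T ↦ g(T x)` on a space of `p`-completely bounded maps. -/
noncomputable def pairingLin (x : X) (g : PDual p Y) : S →ₗ[ℂ] ℂ where
  toFun T := g ((T : CB p X Y) x)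
  map_add' T T' := by simp
  map_smul' c T := by simp

/-- The central estimate. The bound splits into two evaluations: a matrix of operators is applied to
`v`, then `w` is applied to the resulting matrix over `Y`. It is phrased for the bare linear
functionals because their complete boundedness, needed to place them in `S'`, is deduced from it. -/
theorem matPCBBound_pairingLin {ρ σ : Type*} [Fintype ρ] [Fintype σ] (v : Matrix ρ ρ X)
    (w : Matrix σ σ (PDual p Y)) :
    MatPCBBound p (Matrix.of fun a b : ρ × σ => pairingLin S (v a.1 b.1) (w a.2 b.2))
      (fnorm p v * fnorm p w) := by
  intro k A
  have h1 := CB.fnorm_amplify_le (A.map S.subtype) v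
  have h2 := CB.fnorm_amplify_le w (amplify ((A.map S.subtype).map CB.toLin) v)
  -- The matrix norms of `S` are inherited, so nothing is lost in passing to `CB_p(X, Y)`.
  have h3 : fnorm p (A.map S.subtype) = POperatorStructure.mnorm p k A := fnorm_fin p _
  rw [h3] at h1
  refine le_trans (le_of_eq ?_) (h2.trans ((mul_le_mul_of_nonneg_left h1 (fnorm_nonneg p w)).trans
    (le_of_eq (by ring))))
  -- The iterated amplification is indexed by `(ρ × Fin k) × σ`, the goal by `Fin k × (ρ × σ)`. The
  -- same bijection acts on rows and columns, so the norm is unchanged.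
  rw [← fnorm_submatrix p (amplify (w.map CB.toLin) (amplify ((A.map S.subtype).map CB.toLin) v))
    ((Equiv.prodAssoc (Fin k) ρ σ).symm.trans
      (Equiv.prodCongr (Equiv.prodComm (Fin k) ρ) (Equiv.refl σ)))]
  rfl

/-- The case of `1 × 1` matrices `v` and `w` of `matPCBBound_pairingLin`; it makes `T ↦ g (T x)` an
element of `S'`. -/
theorem pcbBound_pairingLin (x : X) (g : PDual p Y) :
    PCBBound p (pairingLin S x g) (‖x‖ * ‖g‖) := by
  intro n A
  have h := matPCBBound_pairingLin S (Matrix.of fun _ _ : Fin 1 => x)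
    (Matrix.of fun _ _ : Fin 1 => g) n A
  rw [fnorm_fin_one, fnorm_fin_one] at h
  refine le_trans ?_ h
  rw [← fnorm_fin]
  -- The amplification is indexed by `Fin n × (Fin 1 × Fin 1)`; restricting to the indices `(i, (0,
  -- 0))` recovers the entrywise image of `A`.
  exact fnorm_submatrix_le p
    (amplify (Matrix.of fun _ _ : Fin 1 × Fin 1 => pairingLin S x g) A)
    (f := fun i : Fin n => (i, ((0 : Fin 1), (0 : Fin 1))))
    (g := fun i : Fin n => (i, ((0 : Fin 1), (0 : Fin 1))))
    (fun a b hab => congrArg Prod.fst hab) (fun a b hab => congrArg Prod.fst hab)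

/-- The bilinear map that sends `(x, g)` to the functional `T ↦ g(T x)`. -/
noncomputable def pairing : X →ₗ[ℂ] PDual p Y →ₗ[ℂ] PDual p S :=
  LinearMap.mk₂ ℂ
    (fun x g => CB.mk (pairingLin S x g) ⟨‖x‖ * ‖g‖, by positivity, pcbBound_pairingLin S x g⟩)
    (fun x x' g => CB.toLin_injective (by ext T; simp [CB.toLin_mk, pairingLin]))
    (fun c x g => CB.toLin_injective (by ext T; simp [CB.toLin_mk, pairingLin]))
    (fun x g g' => CB.toLin_injective (by ext T; simp [CB.toLin_mk, pairingLin]))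
    (fun c x g => CB.toLin_injective (by ext T; simp [CB.toLin_mk, pairingLin]))

theorem pairing_apply (x : X) (g : PDual p Y) (T : S) :
    pairing S x g T = g ((T : CB p X Y) x) := rfl

/-- Since `M_{r × s}(S')` is normed as `CB_p(S, M_{r × s}(ℂ))`, the claim is the estimate of
`matPCBBound_pairingLin` read as a bound on a norm. -/
theorem isJointlyPCompletelyContractive_pairing :
    IsJointlyPCompletelyContractive p (pairing S) := by
  intro r s v w
  rw [← fnorm_fin, ← fnorm_fin]
  exact CB.fnorm_le_of_matPCBBound _ (mul_nonneg (fnorm_nonneg p v) (fnorm_nonneg p w))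
    (matPCBBound_pairingLin S v w)

end Pairing

/-! ### Functionals on the injective tensor product and uniqueness of the bilinear map. -/

section InjTensor

variable {p : ℝ} [Fact (1 < p)] {V : Type*} [NormedAddCommGroup V] [NormedSpace ℂ V]
  [POperatorStructure p V] {W : Type*} [NormedAddCommGroup W] [NormedSpace ℂ W]
  [POperatorStructure p W]

/-- The tensor `x ⊗ y` acts as the rank-one operator `f ↦ f(x) y`, so `g` of its value at `f` is
`g(f(x) y)`, and linearity of `g` takes out the scalar. -/
theorem pairing_injTmul (f : PDual p V) (g : PDual p W) (x : V) (y : W) :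
    pairing (InjTensor p V W) f g (injTmul p x y) = f x * g y := by
  rw [pairing_apply]
  change g (injMap p V W (x ⊗ₜ y) f) = _
  have h : injMap p V W (x ⊗ₜ y) = rankOne p x y := by simp [injMap]
  rw [h, rankOne_apply, map_smul, smul_eq_mul]

theorem CB.continuous {X Y : Type*} [SeminormedAddCommGroup X] [NormedSpace ℂ X]
    [POperatorStructure p X] [NormedAddCommGroup Y] [NormedSpace ℂ Y] [POperatorStructure p Y]
    (u : CB p X Y) : Continuous fun x => u x :=
  ((CB.toLin u).mkContinuous ‖u‖ (CB.norm_apply_le u)).continuous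

/-- A `p`-completely bounded functional on the injective tensor product is determined by its
values on elementary tensors. -/
theorem injTensor_dual_ext {φ φ' : PDual p (InjTensor p V W)}
    (h : ∀ x y, φ (injTmul p x y) = φ' (injTmul p x y)) : φ = φ' := by
  let S := LinearMap.range (injMap p V W)
  let incl : S →ₗ[ℂ] InjTensor p V W := Submodule.inclusion S.le_topologicalClosure
  -- Density is meant in the closure with its subspace topology; `Subtype.dense_iff` moves it to the
  -- ambient space, where it is the definition of the closure.
  have hd : DenseRange incl := by
    rw [DenseRange, Subtype.dense_iff]
    intro T hT
    refine closure_mono ?_ hT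
    intro T hT
    exact ⟨⟨T, S.le_topologicalClosure hT⟩, ⟨⟨T, hT⟩, rfl⟩, rfl⟩
  -- Both functionals are pulled back to the algebraic tensor product, where a linear map is
  -- determined by elementary tensors.
  have key : ∀ z : V ⊗[ℂ] W, φ (incl ⟨injMap p V W z, z, rfl⟩) =
      φ' (incl ⟨injMap p V W z, z, rfl⟩) := by
    let j : V ⊗[ℂ] W →ₗ[ℂ] InjTensor p V W := incl ∘ₗ (injMap p V W).rangeRestrict
    have hj : CB.toLin φ ∘ₗ j = CB.toLin φ' ∘ₗ j := TensorProduct.ext' fun x y => h x y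
    exact fun z => LinearMap.congr_fun hj z
  refine CB.toLin_injective (DFunLike.coe_injective ?_)
  -- Two continuous maps into a Hausdorff space that agree on a dense set are equal.
  refine hd.equalizer (CB.continuous φ) (CB.continuous φ') (funext ?_)
  rintro ⟨_, z, rfl⟩
  exact key z

/-- Besides uniqueness, this transfers every property of the evaluation pairing to any `ψ` that is
known only through its values on elementary tensors. -/
theorem eq_pairing {ψ : PDual p V →ₗ[ℂ] PDual p W →ₗ[ℂ] PDual p (InjTensor p V W)}
    (h : ∀ f g (x : V) (y : W), ψ f g (injTmul p x y) = f x * g y) :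
    ψ = pairing (InjTensor p V W) :=
  LinearMap.ext₂ fun f g => injTensor_dual_ext fun x y => by rw [h, pairing_injTmul]

end InjTensor

/-! ### Linearization of jointly `p`-completely contractive maps on the projective tensor product.
-/

section ProjTensor

variable {p : ℝ} [Fact (1 < p)] {X : Type*} [SeminormedAddCommGroup X] [NormedSpace ℂ X]
  [POperatorStructure p X] {Y : Type*} [SeminormedAddCommGroup Y] [NormedSpace ℂ Y]
  [POperatorStructure p Y] {Z : Type*} [SeminormedAddCommGroup Z] [NormedSpace ℂ Z]

/-- The linear map on the algebraic tensor product that corresponds to a bilinear map. -/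
noncomputable def projAlgLift (p : ℝ) [Fact (1 < p)] [POperatorStructure p X]
    [POperatorStructure p Y] (ψ : X →ₗ[ℂ] Y →ₗ[ℂ] Z) : ProjAlg p X Y →ₗ[ℂ] Z :=
  (TensorProduct.lift ψ : X ⊗[ℂ] Y →ₗ[ℂ] Z)

/-- Elementary tensors span `X ⊗ Y`, so they fix `Ψ` on the image of the algebraic tensor product.
This serves both the uniqueness of `Ψ` and the reduction of its matrix bounds to the dense part. -/
theorem eq_projAlgLift {Ψ : ProjTensor p X Y →L[ℂ] Z} {ψ : X →ₗ[ℂ] Y →ₗ[ℂ] Z}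
    (h : ∀ x y, Ψ (projTmul p x y) = ψ x y) (z : ProjAlg p X Y) :
    Ψ (z : ProjTensor p X Y) = projAlgLift p ψ z := by
  let j : X ⊗[ℂ] Y →ₗ[ℂ] ProjTensor p X Y :=
    (UniformSpace.Completion.toComplL (𝕜 := ℂ) (E := ProjAlg p X Y)).toLinearMap
  have hj : Ψ.toLinearMap ∘ₗ j = TensorProduct.lift ψ := TensorProduct.ext' fun x y =>
    (h x y).trans (TensorProduct.lift.tmul x y).symm
  exact LinearMap.congr_fun hj z

variable [POperatorStructure p Z]

/-- Each representation `u = α (v ⊗ w) β` is carried to `α [ψ(v_{ij}, w_{kl})] β`, whose norm the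
axiom for scalar multiplication and the hypothesis on `ψ` bound by `‖α‖ ‖v‖ ‖w‖ ‖β‖`. -/
theorem isPCompletelyContractive_projAlgLift {ψ : X →ₗ[ℂ] Y →ₗ[ℂ] Z}
    (hψ : IsJointlyPCompletelyContractive p ψ) :
    IsPCompletelyContractive p (projAlgLift p ψ) := by
  intro n u
  rw [one_mul]
  -- The matrix norm of `ProjAlg` is by definition the infimum of `projSet`, so a lower bound for
  -- every representation suffices.
  refine le_csInf (projSet_nonempty p (X := X) (Y := Y) u) ?_
  rintro _ ⟨r, s, α, v, w, β, hu, rfl⟩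
  have h : u.map (projAlgLift p ψ) = compress α
      (Matrix.of fun a b : Fin r × Fin s => ψ (v a.1 b.1) (w a.2 b.2)) β := by
    have h' : u.map (projAlgLift p ψ) = (compress α (kron v w) β).map (TensorProduct.lift ψ) :=
      congrArg (fun u : Matrix (Fin n) (Fin n) (X ⊗[ℂ] Y) => u.map (TensorProduct.lift ψ)) hu
    rw [h', compress_map]
    congr 1
  rw [h, ← fnorm_fin]
  refine (fnorm_compress_le p _ _ _).trans ?_
  have h1 := lpOpNorm_nonneg p α
  have h2 := lpOpNorm_nonneg p β
  rw [mul_assoc (lpOpNorm p α) (POperatorStructure.mnorm p r v)]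
  gcongr
  exact hψ r s v w

/-- The first matrix level of complete contractivity; it supplies the norm bound that allows
extension to the completion. -/
theorem IsPCompletelyContractive.norm_apply_le {u : X →ₗ[ℂ] Z}
    (hu : IsPCompletelyContractive p u) (x : X) : ‖u x‖ ≤ 1 * ‖x‖ := by
  have h := hu 1 (Matrix.of fun _ _ => x)
  rwa [POperatorStructure.mnorm_one, POperatorStructure.mnorm_one] at h

/-- A continuous linear map on the completion is `p`-completely contractive if its restriction
is. -/
theorem isPCompletelyContractive_of_completion {u : UniformSpace.Completion X →L[ℂ] Z}
    {u₀ : X →ₗ[ℂ] Z} (hu : ∀ x : X, u (x : UniformSpace.Completion X) = u₀ x)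
    (hu₀ : IsPCompletelyContractive p u₀) : IsPCompletelyContractive p u.toLinearMap := by
  intro n A
  have hc : Continuous fun A : Matrix (Fin n) (Fin n) (UniformSpace.Completion X) =>
      A.map u.toLinearMap := continuous_id.matrix_map u.continuous
  -- Both sides are continuous in the entries of `A`, so the inequality is a closed condition, and
  -- it is enough to check it on matrices over the dense subspace.
  refine compl_induction (P := fun A => POperatorStructure.mnorm p n (A.map u.toLinearMap) ≤
    1 * complNorm p n A) (isClosed_le ((continuous_mnorm p n).comp hc)
      (continuous_const.mul (continuous_complNorm p n))) (fun A => ?_) A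
  have h : (A.map ((↑) : X → UniformSpace.Completion X)).map u.toLinearMap = A.map u₀ := by
    ext i j
    exact hu (A i j)
  rw [h, complNorm_coe]
  exact hu₀ n A

/-- Universal property of the projective tensor product. -/
theorem existsUnique_projTensor_lift {Z : Type*} [NormedAddCommGroup Z] [NormedSpace ℂ Z]
    [CompleteSpace Z] [POperatorStructure p Z] {ψ : X →ₗ[ℂ] Y →ₗ[ℂ] Z}
    (hψ : IsJointlyPCompletelyContractive p ψ) :
    ∃! Ψ : ProjTensor p X Y →L[ℂ] Z, ∀ x y, Ψ (projTmul p x y) = ψ x y := by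
  let e : ProjAlg p X Y →ₗ[ℂ] ProjTensor p X Y :=
    (UniformSpace.Completion.toComplL (𝕜 := ℂ) (E := ProjAlg p X Y)).toLinearMap
  have he : DenseRange e := UniformSpace.Completion.denseRange_coe
  -- The bound is by `‖e z‖`, which equals `‖z‖`. It also makes the lift vanish on the kernel of
  -- `e`, so injectivity of `e` is not needed for the extension.
  have hb : ∀ z, ‖projAlgLift p ψ z‖ ≤ 1 * ‖e z‖ := fun z =>
    ((isPCompletelyContractive_projAlgLift hψ).norm_apply_le z).trans
      (le_of_eq (congrArg (1 * ·) (UniformSpace.Completion.norm_coe z).symm))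
  refine ⟨(projAlgLift p ψ).extendOfNorm e, fun x y => ?_, fun Ψ hΨ => ?_⟩
  · exact (LinearMap.extendOfNorm_eq he ⟨1, hb⟩ (x ⊗ₜ[ℂ] y : X ⊗[ℂ] Y)).trans
      (TensorProduct.lift.tmul x y)
  -- A competing `Ψ` agrees with the lift on algebraic tensors by `eq_projAlgLift`, hence is the
  -- extension by density.
  · exact (LinearMap.extendOfNorm_unique he 1 hb Ψ
      (LinearMap.ext fun z => eq_projAlgLift hΨ z)).symm

end ProjTensor

end POperator

/-! ### The canonical map from the projective tensor product of duals to the dual of the injective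
one. -/

theorem mainTheorem6 (p : ℝ) [Fact (1 < p)]
    (V : Type*) [NormedAddCommGroup V] [NormedSpace ℂ V] [CompleteSpace V]
    [POperator.POperatorStructure p V]
    (W : Type*) [NormedAddCommGroup W] [NormedSpace ℂ W] [CompleteSpace W]
    [POperator.POperatorStructure p W] :
    -- the bilinear map `(f, g) ↦ f ⊗ g` exists and is determined by its values on tensors
    (∃! ψ : POperator.PDual p V →ₗ[ℂ] POperator.PDual p W →ₗ[ℂ]
        POperator.PDual p (POperator.InjTensor p V W),
      ∀ f g (x : V) (y : W), ψ f g (POperator.injTmul p x y) = f x * g y) ∧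
    ∀ ψ : POperator.PDual p V →ₗ[ℂ] POperator.PDual p W →ₗ[ℂ]
        POperator.PDual p (POperator.InjTensor p V W),
      (∀ f g (x : V) (y : W), ψ f g (POperator.injTmul p x y) = f x * g y) →
      POperator.IsJointlyPCompletelyContractive p ψ ∧
      -- the canonical map on the projective tensor product
      (∃! Ψ : POperator.ProjTensor p (POperator.PDual p V) (POperator.PDual p W) →L[ℂ]
          POperator.PDual p (POperator.InjTensor p V W),
        ∀ f g, Ψ (POperator.projTmul p f g) = ψ f g) ∧
      ∀ Ψ : POperator.ProjTensor p (POperator.PDual p V) (POperator.PDual p W) →L[ℂ]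
          POperator.PDual p (POperator.InjTensor p V W),
        (∀ f g, Ψ (POperator.projTmul p f g) = ψ f g) →
        POperator.IsPCompletelyContractive p Ψ.toLinearMap := by
  have hext := fun ψ h => POperator.eq_pairing (p := p) (V := V) (W := W) (ψ := ψ) h
  refine ⟨⟨POperator.pairing _, POperator.pairing_injTmul, hext⟩, fun ψ hψ => ?_⟩
  have hJ : POperator.IsJointlyPCompletelyContractive p ψ := by
    -- The values on elementary tensors force `ψ` to be the evaluation pairing, for which the
    -- estimate is known.
    rw [hext ψ hψ]
    exact POperator.isJointlyPCompletelyContractive_pairing _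
  -- The extension exists because `CB_p(·, ℂ)` is complete, `ℂ` being complete. Complete
  -- contractivity of `Ψ` is inherited from its restriction to the algebraic tensor product.
  exact ⟨hJ, POperator.existsUnique_projTensor_lift hJ, fun Ψ hΨ =>
    POperator.isPCompletelyContractive_of_completion (POperator.eq_projAlgLift hΨ)
      (POperator.isPCompletelyContractive_projAlgLift hJ)⟩
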